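/- For $r>0$ let $S^2(r)\subset\mathbb{R}^3$ be the round sphere of radius $r$ centred at the origin, with its area form $\mathrm{area}_{S^2(r)}$. Products of such spheres carry the direct sum $\omega$ of the area forms of the factors. The Hamiltonian vector field of a function $F$ is given by $\omega(X_F,\cdot)=-dF$. For a closed symplectic manifold $(X^{2n},\omega)$ put $\mathrm{Vol}(X)=\int_X\omega^n$. An $S^1$-action $\{f_t\}$, $t\in\mathbb{R}/\mathbb{Z}$, is generated by $F$ if it is the flow of $X_F$. A fixed point $z$ of it is Maslov-zero if the loop $\{d_zf_t\}_{t\in[0,1]}\subset Sp(T_zX,\omega)$ has Maslov index $0$. Let $r_1,r_2>0$ with $r_1\neq r_2$. (1) Let $X=S^2(r_1)\times S^2(r_2)$ with $\omega=\mathrm{area}_{S^2(r_1)}\oplus\mathrm{area}_{S^2(r_2)}$, let $F(\alpha,\beta)=2\pi r_1\alpha_3+2\pi r_2\beta_3$ and $s=((0,0,r_1),(0,0,-r_2))$. Then $(X,\omega)$ is a closed symplectic manifold, the Hamiltonian flow of $F$ is a smooth $S^1$-action, $s$ is a Maslov-zero fixed point of it, $F(s)=2\pi r_1^2-2\pi r_2^2$,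 and $$\int_X F\,\omega^2=0\neq \mathrm{Vol}(X)\cdot F(s).$$ (2) Let $m\ge 2$, let $X=S^2(r_1)\times\dots\times S^2(r_1)\times S^2(r_2)$ with $m$ factors, let $h_i$ be the height function (third coordinate) of the $i$-th factor, let $$F=2\pi\bigl(r_1h_1+\dots+r_1h_{m-1}+(m-1)\,r_2h_m\bigr)$$ and $s=((0,0,r_1),\dots,(0,0,r_1),(0,0,-r_2))$. Then $(X,\omega)$ is a closed symplectic manifold, the Hamiltonian flow of $F$ is a smooth $S^1$-action, $s$ is a Maslov-zero fixed point of it, $F(s)\neq0$, and $$\int_X F\,\omega^m=0\neq \mathrm{Vol}(X)\cdot F(s).$$ In both cases $(X,\omega)$ is therefore a closed symplectic manifold with a Hamiltonian $S^1$-action generated by $F$ and a Maslov-zero fixed point $s$ such that $\int_X F\,\omega^n\neq\mathrm{Vol}(X)\cdot F(s)$, where $\dim X=2n$. -/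

import Mathlib

open Set MeasureTheory Module
open scoped Manifold ContDiff BigOperators

noncomputable section

namespace HamLoop

/-! ## Symplectic linear algebra -/

section Linear

variable {V : Type*} [NormedAddCommGroup V] [NormedSpace ℝ V]

/-- The value `(α ∧ ⋯ ∧ α) (v₁, …, v₂ₙ)` of the `n`-th exterior power of a `2`-form `α`; the
vectors are indexed by pairs in the order `(0,0), (0,1), (1,0), (1,1), …`. -/
def wedgePow (n : ℕ) (α : V [⋀^Fin 2]→L[ℝ] ℝ) (v : Fin n × Fin 2 → V) : ℝ :=
  (2 ^ n : ℝ)⁻¹ * ∑ σ : Equiv.Perm (Fin n × Fin 2),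
    ((Equiv.Perm.sign σ : ℤ) : ℝ) * ∏ i : Fin n, α (fun j => v (σ (i, j)))

/-- A symplectic basis `∂x₁, …, ∂xₙ, ∂y₁, …, ∂yₙ` (`inl` for `∂x`, `inr` for `∂y`), that is, one in
which `α = ∑ dxᵢ ∧ dyᵢ`. -/
def IsSymplecticBasis {n : ℕ} (α : V [⋀^Fin 2]→L[ℝ] ℝ) (b : Basis (Fin n ⊕ Fin n) ℝ V) : Prop :=
  ∀ i j : Fin n,
    α ![b (.inl i), b (.inl j)] = 0 ∧ α ![b (.inr i), b (.inr j)] = 0 ∧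
    α ![b (.inl i), b (.inr j)] = if i = j then 1 else 0

/-- The real `2n × 2n` matrix of the complex matrix `X + iY`, for `z = x + iy`. -/
def realify {n : ℕ} (Z : Matrix (Fin n) (Fin n) ℂ) :
    Matrix (Fin n ⊕ Fin n) (Fin n ⊕ Fin n) ℝ :=
  Matrix.fromBlocks (Z.map Complex.re) (-(Z.map Complex.im)) (Z.map Complex.im) (Z.map Complex.re)

/-- `Ψ`, restricted to `[0,1]`, is a continuous loop in the group `Sp(V, α)`
(a map preserving a nondegenerate `α` is invertible). -/
structure IsSymplecticLoop (α : V [⋀^Fin 2]→L[ℝ] ℝ) (Ψ : ℝ → V →L[ℝ] V) : Prop where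
  continuousOn : ContinuousOn Ψ (Icc 0 1)
  closed : Ψ 0 = Ψ 1
  preserves : ∀ t ∈ Icc (0 : ℝ) 1, ∀ u v : V, α ![Ψ t u, Ψ t v] = α ![u, v]

/-- The loop `Ψ` in `Sp(V, α)` has Maslov index `k`: if `Ψ t = P t * U t` is the polar decomposition
of its matrix in a symplectic basis, with `P t` symmetric positive definite and `U t = X + iY`
unitary, then the loop `t ↦ det_ℂ (X + iY)` in the unit circle has winding number `k`.
(The polar decomposition is unique, and `k` does not depend on the symplectic basis.) -/
def HasMaslovIndex (n : ℕ) (α : V [⋀^Fin 2]→L[ℝ] ℝ) (Ψ : ℝ → V →L[ℝ] V) (k : ℤ) : Prop :=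
  IsSymplecticLoop α Ψ ∧
  ∃ b : Basis (Fin n ⊕ Fin n) ℝ V, IsSymplecticBasis α b ∧
    ∃ (P : ℝ → Matrix (Fin n ⊕ Fin n) (Fin n ⊕ Fin n) ℝ) (Z : ℝ → Matrix (Fin n) (Fin n) ℂ)
      (θ : ℝ → ℝ),
      (∀ t ∈ Icc (0 : ℝ) 1,
        (P t).PosDef ∧ Z t ∈ Matrix.unitaryGroup (Fin n) ℂ ∧
        LinearMap.toMatrix b b (Ψ t).toLinearMap = P t * realify (Z t) ∧
        (Z t).det = Complex.exp (θ t * Complex.I)) ∧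
      ContinuousOn θ (Icc 0 1) ∧ θ 1 - θ 0 = 2 * Real.pi * k

end Linear

/-! ## Closed symplectic manifolds and Hamiltonian circle actions -/

section Manifold

variable {E : Type*} [NormedAddCommGroup E] [NormedSpace ℝ E]
  {M : Type*} [TopologicalSpace M] [ChartedSpace E M]

/-- A (not necessarily smooth) differential `2`-form on `M`. -/
abbrev TwoForm (E : Type*) [NormedAddCommGroup E] [NormedSpace ℝ E]
    (M : Type*) [TopologicalSpace M] [ChartedSpace E M] : Type _ :=
  ∀ x : M, TangentSpace 𝓘(ℝ, E) x [⋀^Fin 2]→L[ℝ] ℝ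

/-- The expression `(e⁻¹)^* Ω` of a `2`-form in a chart `e` (meaningful on `e.target`). -/
def localForm (Ω : TwoForm E M) (e : OpenPartialHomeomorph M E) (y : E) :
    E [⋀^Fin 2]→L[ℝ] ℝ :=
  (Ω (e.symm y)).compContinuousLinearMap
    (mfderiv 𝓘(ℝ, E) 𝓘(ℝ, E) e.symm y : E →L[ℝ] TangentSpace 𝓘(ℝ, E) (e.symm y))

/-- `(M, Ω)` is a closed symplectic manifold of dimension `2n`: `M` is compact Hausdorff (its charts
are in a vector space, so it has no boundary), and `Ω` is smooth, closed and nondegenerate. -/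
structure IsClosedSymplecticManifold (n : ℕ) (Ω : TwoForm E M) : Prop where
  isManifold : IsManifold 𝓘(ℝ, E) ∞ M
  compactSpace : CompactSpace M
  t2Space : T2Space M
  finrank_eq : finrank ℝ E = 2 * n
  finiteDimensional : FiniteDimensional ℝ E
  smooth : ∀ e ∈ IsManifold.maximalAtlas 𝓘(ℝ, E) ∞ M, ContDiffOn ℝ ∞ (localForm Ω e) e.target
  closed : ∀ e ∈ IsManifold.maximalAtlas 𝓘(ℝ, E) ∞ M, ∀ y ∈ e.target,
    extDeriv (localForm Ω e) y = 0
  nondegenerate : ∀ (x : M) (u : TangentSpace 𝓘(ℝ, E) x),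
    (∀ v : TangentSpace 𝓘(ℝ, E) x, Ω x ![u, v] = 0) → u = 0

/-- `f` is a smooth `S¹ = ℝ/ℤ`-action on `M` which is the flow of the Hamiltonian vector field of
the smooth function `F`, with the sign convention `Ω (X_F, ·) = -dF`. -/
structure IsHamiltonianCircleAction (Ω : TwoForm E M) (F : M → ℝ) (f : ℝ → M → M) : Prop where
  smooth_hamiltonian : ContMDiff 𝓘(ℝ, E) 𝓘(ℝ, ℝ) ∞ F
  smooth : ContMDiff (𝓘(ℝ, ℝ).prod 𝓘(ℝ, E)) 𝓘(ℝ, E) ∞ (fun p : ℝ × M => f p.1 p.2)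
  zero : ∀ x, f 0 x = x
  add : ∀ s t x, f (s + t) x = f s (f t x)
  one : ∀ x, f 1 x = x
  generated : ∀ (t : ℝ) (x : M) (v : TangentSpace 𝓘(ℝ, E) (f t x)),
    Ω (f t x) ![mfderiv 𝓘(ℝ, ℝ) 𝓘(ℝ, E) (fun τ => f τ x) t (1 : ℝ), v] =
      -mvfderiv 𝓘(ℝ, E) F (f t x) v

/-- The loop `t ↦ d_z f_t` at a common fixed point `z` of all the maps `f t`, so that
`T_z M = T_{f t z} M` (both are the model space, through the preferred chart at `z = f t z`). -/
def linearizedLoop (f : ℝ → M → M) (z : M) : ℝ → E →L[ℝ] E :=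
  fun t => (mfderiv 𝓘(ℝ, E) 𝓘(ℝ, E) (f t) z : E →L[ℝ] E)

/-- `z` is a Maslov-zero fixed point of `f`: it is a fixed point, and the loop
`t ↦ d_z f_t` in `Sp(T_z M, Ω_z)` has Maslov index `0`. -/
def IsMaslovZeroFixedPoint (n : ℕ) (Ω : TwoForm E M) (f : ℝ → M → M) (z : M) : Prop :=
  (∀ t, f t z = z) ∧
    HasMaslovIndex (V := E) n (Ω z) (linearizedLoop f z) 0

variable [FiniteDimensional ℝ E] [MeasurableSpace E] [BorelSpace E] [MeasurableSpace M]

/-- The measure on the domain of the chart `e` that is given by the top form `Ωⁿ`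
(and the orientation for which it is positive): in the chart it has the density
`|Ωⁿ(b₁, …, b₂ₙ)|` with respect to the Lebesgue measure normalized on the parallelepiped of a basis
`b` of the model space. It does not depend on `b`. -/
def chartVolume (n : ℕ) (hE : finrank ℝ E = 2 * n) (Ω : TwoForm E M)
    (e : OpenPartialHomeomorph M E) : Measure M :=
  let b : Basis (Fin n × Fin 2) ℝ E :=
    (finBasisOfFinrankEq ℝ E (hE.trans (mul_comm 2 n))).reindex finProdFinEquiv.symm
  ((b.addHaar.restrict e.target).withDensity
    (fun y => ENNReal.ofReal |wedgePow n (localForm Ω e y) b|)).map e.symm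

/-- The measure on `M` given by integration of `Ωⁿ`, that is, the measure whose restriction to the
domain of each smooth chart `e` is `chartVolume n hE Ω e`. As these are restrictions of one measure
to open sets, countably many of which cover `M`, that measure is their least upper bound. -/
def symplecticVolume (n : ℕ) (hE : finrank ℝ E = 2 * n) (Ω : TwoForm E M) : Measure M :=
  ⨆ e ∈ IsManifold.maximalAtlas 𝓘(ℝ, E) ∞ M, chartVolume n hE Ω e

/-- The data `(M, Ω, F, f, z)` of a Hamiltonian circle action `f`, generated by `F`, on a closed
symplectic manifold, and of a Maslov-zero fixed point `z` with `∫ F Ωⁿ ≠ Vol(M) F(z)`, where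
`Vol(M) = ∫ Ωⁿ` is finite and `F` is integrable. -/
structure IsMaslovZeroUnbalanced (n : ℕ) (hE : finrank ℝ E = 2 * n) (Ω : TwoForm E M)
    (F : M → ℝ) (f : ℝ → M → M) (z : M) : Prop where
  symplectic : IsClosedSymplecticManifold n Ω
  action : IsHamiltonianCircleAction Ω F f
  maslov : IsMaslovZeroFixedPoint n Ω f z
  volume_ne_top : symplecticVolume n hE Ω univ ≠ ⊤
  integrable : Integrable F (symplecticVolume n hE Ω)
  integral_ne : ∫ x, F x ∂(symplecticVolume n hE Ω) ≠ (symplecticVolume n hE Ω).real univ * F z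

end Manifold

/-! ## Products of round spheres in `ℝ³` -/

/-- Three-dimensional Euclidean space. -/
abbrev R3 : Type := EuclideanSpace ℝ (Fin 3)

/-- A radius is a positive real number. -/
abbrev Radius : Type := {r : ℝ // 0 < r}

/-- The round sphere `S²(r) ⊂ ℝ³` of radius `r`, centred at the origin. -/
abbrev RoundSphere (r : Radius) : Type := Metric.sphere (0 : R3) r.1

/-- The homeomorphism `x ↦ x / r` of `S²(r)` onto the unit sphere. -/
def toUnit (r : Radius) : RoundSphere r ≃ₜ Metric.sphere (0 : R3) 1 where
  toFun x := ⟨r.1⁻¹ • x.1, by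
    have h := mem_sphere_zero_iff_norm.1 x.2
    simp [norm_smul, h, abs_of_pos r.2, r.2.ne']⟩
  invFun x := ⟨r.1 • x.1, by
    have h := mem_sphere_zero_iff_norm.1 x.2
    simp [norm_smul, h, abs_of_pos r.2]⟩
  left_inv x := Subtype.ext (by simp [smul_smul, r.2.ne'])
  right_inv x := Subtype.ext (by simp [smul_smul, r.2.ne'])
  continuous_toFun := by fun_prop
  continuous_invFun := by fun_prop

instance : Fact (finrank ℝ R3 = 2 + 1) := ⟨finrank_euclideanSpace_fin⟩

/-- The chart `x ↦ stereographic projection of x / r` of `S²(r)`, from the pole `r • v`. -/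
def sphereChart (r : Radius) (v : Metric.sphere (0 : R3) 1) :
    OpenPartialHomeomorph (RoundSphere r) (EuclideanSpace ℝ (Fin 2)) :=
  (toUnit r).toOpenPartialHomeomorph ≫ₕ stereographic' 2 v

theorem mem_sphereChart_source (r : Radius) (x : RoundSphere r) :
    x ∈ (sphereChart r (-toUnit r x)).source := by
  have h : toUnit r x ≠ -toUnit r x := ne_neg_of_mem_unit_sphere ℝ (toUnit r x)
  refine ⟨trivial, ?_⟩
  simpa [stereographic'_source] using h

theorem contDiffOn_sphereChart (r : Radius) (v w : Metric.sphere (0 : R3) 1) :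
    ContDiffOn ℝ ∞ (sphereChart r w ∘ (sphereChart r v).symm)
      ((sphereChart r v).target ∩ (sphereChart r v).symm ⁻¹' (sphereChart r w).source) := by
  have h := (contDiffGroupoid ω (𝓡 2)).compatible
    (show stereographic' 2 v ∈ atlas _ (Metric.sphere (0 : R3) 1) from ⟨_, rfl⟩)
    (show stereographic' 2 w ∈ atlas _ (Metric.sphere (0 : R3) 1) from ⟨_, rfl⟩)
  rw [contDiffGroupoid, mem_groupoid_of_pregroupoid] at h
  have h1 : ContDiffOn ℝ ∞ (stereographic' 2 w ∘ (stereographic' 2 v).symm)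
      ((stereographic' 2 v).symm ≫ₕ stereographic' 2 w).source := by
    simpa [contDiffPregroupoid] using h.1.of_le le_top
  refine (h1.congr fun y _ => ?_).mono fun y hy => ?_
  · simp [sphereChart]
  · simpa [sphereChart] using hy

/-- The product `S²(r₀) × ⋯ × S²(r_{m-1}) ⊂ (ℝ³)ᵐ`. -/
def SphereProduct {m : ℕ} (r : Fin m → Radius) : Type := ∀ i, RoundSphere (r i)

/-- The model space of a product of `m` spheres. -/
abbrev ModelSpace (m : ℕ) : Type := Fin m → EuclideanSpace ℝ (Fin 2)

theorem finrank_modelSpace (m : ℕ) : finrank ℝ (ModelSpace m) = 2 * m := by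
  simp [ModelSpace, Module.finrank_pi_fintype, mul_comm]

section Product

variable {m : ℕ} (r : Fin m → Radius)

instance : TopologicalSpace (SphereProduct r) :=
  inferInstanceAs (TopologicalSpace (∀ i, RoundSphere (r i)))

instance : MeasurableSpace (SphereProduct r) := borel _

instance : BorelSpace (SphereProduct r) := ⟨rfl⟩

/-- The product of the charts of the factors from the poles `r i • v i`. -/
def productChart (v : Fin m → Metric.sphere (0 : R3) 1) :
    OpenPartialHomeomorph (SphereProduct r) (ModelSpace m) :=
  OpenPartialHomeomorph.pi fun i => sphereChart (r i) (v i)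

instance : ChartedSpace (ModelSpace m) (SphereProduct r) where
  atlas := range (productChart r)
  chartAt x := productChart r fun i => -toUnit (r i) (x i)
  mem_chart_source x i _ := mem_sphereChart_source (r i) (x i)
  chart_mem_atlas _ := ⟨_, rfl⟩

instance : IsManifold 𝓘(ℝ, ModelSpace m) ∞ (SphereProduct r) := by
  apply isManifold_of_contDiffOn
  rintro _ _ ⟨v, rfl⟩ ⟨w, rfl⟩
  refine contDiffOn_pi.2 fun i => ?_
  refine ((contDiffOn_sphereChart (r i) (v i) (w i)).comp (f := fun y : ModelSpace m => y i)
    (contDiff_apply ℝ _ i).contDiffOn (fun y hy => hy)).mono ?_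
  rintro y ⟨⟨h1, h2⟩, -⟩
  exact ⟨h1 i (mem_univ i), h2 i (mem_univ i)⟩

/-- The inclusion of the `i`-th factor in `ℝ³`, as a function on the product. -/
def coord (i : Fin m) (x : SphereProduct r) : R3 := (x i).1

/-- The height (third coordinate) of the point in the `i`-th factor. -/
def height (i : Fin m) (x : SphereProduct r) : ℝ := coord r i x 2

/-- The determinant on `ℝ³`. -/
def det3 : R3 [⋀^Fin 3]→L[ℝ] ℝ :=
  { (EuclideanSpace.basisFun (Fin 3) ℝ).toBasis.det with
    cont := by
      have h : ∀ v : Fin 3 → R3, (EuclideanSpace.basisFun (Fin 3) ℝ).toBasis.det v =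
          (Matrix.of fun i j => v j i).det := fun v => by
        rw [Basis.det_apply]; congr 1
      change Continuous fun v => (EuclideanSpace.basisFun (Fin 3) ℝ).toBasis.det v
      simp only [h]
      refine Continuous.matrix_det ?_
      fun_prop }

/-- The `2`-form `(u, v) ↦ det (p / r, u, v)` on `ℝ³`; on the tangent plane of `S²(r)` at `p` it is
the area form, for the orientation by the outer normal `p / r`. -/
def areaForm (r : Radius) (p : R3) : R3 [⋀^Fin 2]→L[ℝ] ℝ := det3.curryLeft (r.1⁻¹ • p)

/-- The symplectic form `area_{S²(r₀)} ⊕ ⋯ ⊕ area_{S²(r_{m-1})}` on the product: the sum of the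
pull-backs of the area forms of the factors. -/
def productForm : TwoForm (ModelSpace m) (SphereProduct r) := fun x =>
  ∑ i, (areaForm (r i) (coord r i x)).compContinuousLinearMap
    (mvfderiv 𝓘(ℝ, ModelSpace m) (coord r i) x)

/-- The pole `(0, 0, r)`. -/
def northPole (r : Radius) : RoundSphere r :=
  ⟨!₂[0, 0, r.1], by
    simp [EuclideanSpace.norm_eq, Fin.sum_univ_three, Real.sqrt_sq r.2.le]⟩

/-- The pole `(0, 0, -r)`. -/
def southPole (r : Radius) : RoundSphere r :=
  ⟨!₂[0, 0, -r.1], by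
    simp [EuclideanSpace.norm_eq, Fin.sum_univ_three, Real.sqrt_sq r.2.le]⟩

end Product

end HamLoop

end

open HamLoop

/-! Both cases are instances of one construction. Give the `i`-th sphere an integer weight `c i` and
put `F = 2π ∑ c i * r i * h i`. With the convention `Ω (X_F, ·) = -dF`, the flow of `F` rotates the
`i`-th factor about the third axis by the angle `-2π * c i * t`, which has period `1` because the
weights are integers.

A point `s` with a pole in every factor, of signs `ε i`, is fixed. The area form there is `ε i dx ∧
dy`, so `(x, ε i * y)` are symplectic coordinates, and in them the linearized flow is the unitary
matrix `diag (exp (-2πi * ε i * c i * t))`. Its determinant is `exp (-2πi t ∑ ε i * c i)`, so the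
Maslov index vanishes as soon as `∑ ε i * c i = 0`. On the other hand `F s = 2π ∑ ε i * c i * (r
i)²`, in which the radii enter, and this need not vanish when they differ.

The integral of `F` is zero by symmetry: the antipodal map in every factor reverses the sign of `Ω`,
hence preserves the measure of `Ωⁿ`, and it reverses the sign of `F`. The volume is finite and
nonzero, so `Vol * F s ≠ 0`.

All geometry is transported to `ℝ³` by the maps `coord r i`: in a chart the form is a sum of
ordinary pull-backs of `areaForm` (`localForm_productForm`), smoothness into the product can be
tested on coordinates (`contMDiff_of_coord`), and tangent vectors correspond to families of vectors
orthogonal to the positions (`exists_mvfderiv_coord_eq`). The argument rests on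
`isClosedSymplecticManifold_productForm`, `isHamiltonianCircleAction_rotationAction`,
`IsPole.isMaslovZeroFixedPoint`, `measurePreserving_antipode` and `IsPole.productVolume_ne_zero`. -/

noncomputable section

namespace HamLoop

/-! ## Linear algebra of `wedgePow` -/

section Wedge

variable {V : Type*} [NormedAddCommGroup V] [NormedSpace ℝ V] {n : ℕ}

/-- The multilinear map `v ↦ ∏ i, α (v (i, 0), v (i, 1))`. -/
def pairProd (n : ℕ) (α : V [⋀^Fin 2]→L[ℝ] ℝ) :
    MultilinearMap ℝ (fun _ : Fin n × Fin 2 => V) ℝ where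
  toFun v := ∏ i : Fin n, α (fun j => v (i, j))
  map_update_add' {inst} v p x y := by
    -- The fields of `MultilinearMap` quantify over the decidability instance; it is fixed here so
    -- that the lemmas on `Function.update` apply.
    obtain rfl : inst = instDecidableEqProd := Subsingleton.elim _ _
    obtain ⟨i, j⟩ := p
    have h1 : ∀ z, (fun k => Function.update v (i, j) z (i, k)) =
        Function.update (fun k => v (i, k)) j z := fun z => by
      ext k; by_cases hk : k = j <;> simp [hk]
    have h2 : ∀ z, ∏ l ∈ Finset.univ.erase i, α (fun k => Function.update v (i, j) z (l, k)) =
        ∏ l ∈ Finset.univ.erase i, α (fun k => v (l, k)) := fun z => by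
      refine Finset.prod_congr rfl fun l hl => ?_
      congr 1; ext k
      simp [Finset.ne_of_mem_erase hl]
    simp only [← Finset.mul_prod_erase _ _ (Finset.mem_univ i), h2, h1]
    rw [α.map_update_add, add_mul]
  map_update_smul' {inst} v p c x := by
    obtain rfl : inst = instDecidableEqProd := Subsingleton.elim _ _
    obtain ⟨i, j⟩ := p
    have h1 : ∀ z, (fun k => Function.update v (i, j) z (i, k)) =
        Function.update (fun k => v (i, k)) j z := fun z => by
      ext k; by_cases hk : k = j <;> simp [hk]
    have h2 : ∀ z, ∏ l ∈ Finset.univ.erase i, α (fun k => Function.update v (i, j) z (l, k)) =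
        ∏ l ∈ Finset.univ.erase i, α (fun k => v (l, k)) := fun z => by
      refine Finset.prod_congr rfl fun l hl => ?_
      congr 1; ext k
      simp [Finset.ne_of_mem_erase hl]
    simp only [← Finset.mul_prod_erase _ _ (Finset.mem_univ i), h2, h1]
    rw [α.map_update_smul, smul_eq_mul, smul_eq_mul, mul_assoc]

theorem wedgePow_eq_alternatization (α : V [⋀^Fin 2]→L[ℝ] ℝ) (v : Fin n × Fin 2 → V) :
    wedgePow n α v = (2 ^ n : ℝ)⁻¹ * MultilinearMap.alternatization (pairProd n α) v := by
  rw [wedgePow, MultilinearMap.alternatization_apply]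
  congr 1
  refine Finset.sum_congr rfl fun σ _ => ?_
  rw [Units.smul_def, zsmul_eq_mul]
  rfl

/-- Alternating forms of top degree are one-dimensional, so such a form is its value on `b` times
`b.det`. -/
theorem wedgePow_eq_mul_det (α : V [⋀^Fin 2]→L[ℝ] ℝ) (b : Basis (Fin n × Fin 2) ℝ V)
    (v : Fin n × Fin 2 → V) : wedgePow n α v = wedgePow n α b * b.det v := by
  rw [wedgePow_eq_alternatization, wedgePow_eq_alternatization,
    AlternatingMap.eq_smul_basis_det b (MultilinearMap.alternatization (pairProd n α))]
  simp [mul_assoc, Basis.det_self]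

theorem wedgePow_compContinuousLinearMap (α : V [⋀^Fin 2]→L[ℝ] ℝ)
    (b : Basis (Fin n × Fin 2) ℝ V) (L : V →L[ℝ] V) :
    wedgePow n (α.compContinuousLinearMap L) b = L.det * wedgePow n α b := by
  have h : wedgePow n (α.compContinuousLinearMap L) b = wedgePow n α (L ∘ b) := rfl
  rw [h, wedgePow_eq_mul_det α b, mul_comm]
  congr 1
  have := b.det_comp (L : V →ₗ[ℝ] V) b
  rw [b.det_self, mul_one] at this
  exact this

theorem wedgePow_neg (α : V [⋀^Fin 2]→L[ℝ] ℝ) (v : Fin n × Fin 2 → V) :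
    |wedgePow n (-α) v| = |wedgePow n α v| := by
  have h : wedgePow n (-α) v = (-1) ^ n * wedgePow n α v := by
    simp only [wedgePow, Finset.mul_sum, ContinuousAlternatingMap.neg_apply, Finset.prod_neg,
      Finset.card_univ, Fintype.card_fin]
    exact Finset.sum_congr rfl fun σ _ => by ring
  rw [h, abs_mul]
  simp

/-- A permutation that keeps pairs together is a permutation `τ` of the pairs after permutations `ρ
i` inside them. `τ` acts on two copies of `Fin n`, so it contributes the sign `(sign τ)² = 1`; the
sign of each `ρ i` is cancelled by the antisymmetry of `α`. -/
theorem sign_mul_prod_pair_eq (α : V [⋀^Fin 2]→L[ℝ] ℝ) (v : Fin n × Fin 2 → V)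
    (σ : Equiv.Perm (Fin n × Fin 2)) (h : ∀ i, (σ (i, 0)).1 = (σ (i, 1)).1) :
    ((Equiv.Perm.sign σ : ℤ) : ℝ) * ∏ i : Fin n, α (fun j => v (σ (i, j))) =
      ∏ i : Fin n, α (fun j => v (i, j)) := by
  have hfst : ∀ i j, (σ (i, j)).1 = (σ (i, 0)).1 := fun i j => by
    fin_cases j
    · rfl
    · exact (h i).symm
  have hsurj : Function.Surjective fun i => (σ (i, 0)).1 := fun i => by
    refine ⟨(σ.symm (i, 0)).1, ?_⟩
    have := hfst (σ.symm (i, 0)).1 (σ.symm (i, 0)).2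
    rw [Prod.mk.eta, Equiv.apply_symm_apply] at this
    exact this.symm
  let τ : Equiv.Perm (Fin n) :=
    Equiv.ofBijective _ ⟨Finite.injective_iff_surjective.2 hsurj, hsurj⟩
  have hinj : ∀ i, Function.Injective fun j => (σ (i, j)).2 := fun i j k hjk => by
    have : σ (i, j) = σ (i, k) := Prod.ext ((hfst i j).trans (hfst i k).symm) hjk
    simpa using σ.injective this
  let ρ : Fin n → Equiv.Perm (Fin 2) := fun i =>
    Equiv.ofBijective _ ⟨hinj i, Finite.injective_iff_surjective.1 (hinj i)⟩
  have hσ : σ = Equiv.prodCongrLeft (fun _ => τ) * Equiv.prodCongrRight ρ := by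
    ext1 ⟨i, j⟩
    exact Prod.ext (hfst i j) rfl
  have hsign : Equiv.Perm.sign σ = ∏ i, Equiv.Perm.sign (ρ i) := by
    rw [hσ, Equiv.Perm.sign_mul, Equiv.Perm.sign_prodCongrLeft, Equiv.Perm.sign_prodCongrRight]
    simp
  have hα : ∀ i, α (fun j => v (σ (i, j))) =
      ((Equiv.Perm.sign (ρ i) : ℤ) : ℝ) * α (fun j => v (τ i, j)) := fun i => by
    have := α.toAlternatingMap.map_perm (fun j => v (τ i, j)) (ρ i)
    rw [Units.smul_def, zsmul_eq_mul] at this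
    refine Eq.trans ?_ this
    change α _ = α _
    congr 1
    ext j
    rw [hσ]
    rfl
  simp only [hα, Finset.prod_mul_distrib]
  rw [hsign, ← mul_assoc, ← Int.cast_prod, ← Int.cast_mul, Units.coe_prod,
    ← Finset.prod_mul_distrib]
  have h1 : ∀ i, ((Equiv.Perm.sign (ρ i) : ℤˣ) : ℤ) * (Equiv.Perm.sign (ρ i) : ℤˣ) = 1 := fun i => by
    rw [← Units.val_mul, Int.units_mul_self, Units.val_one]
  simp only [h1, Finset.prod_const_one, Int.cast_one, one_mul]
  exact Equiv.prod_comp τ fun i => α fun j => v (i, j)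

theorem alternating_apply_pair (α : V [⋀^Fin 2]→L[ℝ] ℝ) (z : Fin 2 → V) :
    α z = α ![z 0, z 1] := by
  congr 1; ext j; fin_cases j <;> rfl

/-- Permutations that split a pair contribute zero, and all others contribute the same product.
Nothing cancels, so it is enough that the identity is among them. -/
theorem wedgePow_ne_zero_of_orthogonal (α : V [⋀^Fin 2]→L[ℝ] ℝ) (v : Fin n × Fin 2 → V)
    (h : ∀ i i', i ≠ i' → ∀ j j', α ![v (i, j), v (i', j')] = 0)
    (hd : ∀ i, α ![v (i, 0), v (i, 1)] ≠ 0) : wedgePow n α v ≠ 0 := by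
  classical
  have hP : ∏ i : Fin n, α (fun j => v (i, j)) ≠ 0 :=
    Finset.prod_ne_zero_iff.2 fun i _ => by rw [alternating_apply_pair]; exact hd i
  have hterm : ∀ σ : Equiv.Perm (Fin n × Fin 2),
      ((Equiv.Perm.sign σ : ℤ) : ℝ) * ∏ i : Fin n, α (fun j => v (σ (i, j))) =
        if ∀ i, (σ (i, 0)).1 = (σ (i, 1)).1 then ∏ i : Fin n, α (fun j => v (i, j)) else 0 := by
    intro σ
    split_ifs with hσ
    · exact sign_mul_prod_pair_eq α v σ hσ
    · push Not at hσ
      obtain ⟨i, hi⟩ := hσ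
      rw [Finset.prod_eq_zero (Finset.mem_univ i), mul_zero]
      rw [alternating_apply_pair]
      exact h _ _ hi _ _
  rw [wedgePow]
  refine mul_ne_zero (by positivity) ?_
  simp only [hterm]
  rw [← Finset.sum_filter, Finset.sum_const, nsmul_eq_mul]
  refine mul_ne_zero (Nat.cast_ne_zero.2 (Finset.card_ne_zero.2 ⟨1, ?_⟩)) hP
  simp

theorem wedgePow_basis_ne_zero_of_orthogonal (α : V [⋀^Fin 2]→L[ℝ] ℝ)
    (b : Basis (Fin n × Fin 2) ℝ V) (v : Fin n × Fin 2 → V)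
    (h : ∀ i i', i ≠ i' → ∀ j j', α ![v (i, j), v (i', j')] = 0)
    (hd : ∀ i, α ![v (i, 0), v (i, 1)] ≠ 0) : wedgePow n α b ≠ 0 := by
  have := wedgePow_ne_zero_of_orthogonal α v h hd
  rw [wedgePow_eq_mul_det α b] at this
  exact left_ne_zero_of_mul this

end Wedge

/-! ## The area form -/

section Area

theorem det3_apply (u v w : R3) : det3 ![u, v, w] =
    u 0 * (v 1 * w 2 - v 2 * w 1) - u 1 * (v 0 * w 2 - v 2 * w 0) +
      u 2 * (v 0 * w 1 - v 1 * w 0) := by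
  change (EuclideanSpace.basisFun (Fin 3) ℝ).toBasis.det ![u, v, w] = _
  rw [Basis.det_apply, Matrix.det_fin_three]
  simp [Basis.toMatrix_apply]
  ring

theorem areaForm_apply (r : Radius) (p u w : R3) : areaForm r p ![u, w] =
    r.1⁻¹ * (p 0 * (u 1 * w 2 - u 2 * w 1) - p 1 * (u 0 * w 2 - u 2 * w 0) +
      p 2 * (u 0 * w 1 - u 1 * w 0)) := by
  change det3 ![r.1⁻¹ • p, u, w] = _
  rw [det3_apply]
  simp
  ring

theorem inner_R3 (u w : R3) : inner ℝ u w = u 0 * w 0 + u 1 * w 1 + u 2 * w 2 := by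
  simp [PiLp.inner_apply, Fin.sum_univ_three]
  ring

theorem R3_ext {u w : R3} (h0 : u 0 = w 0) (h1 : u 1 = w 1) (h2 : u 2 = w 2) : u = w := by
  ext i; fin_cases i <;> assumption

theorem areaForm_nondegenerate (r : Radius) {p u : R3} (hp : inner ℝ p p = r.1 ^ 2)
    (hu : inner ℝ p u = 0) (h : ∀ w : R3, inner ℝ p w = 0 → areaForm r p ![u, w] = 0) :
    u = 0 := by
  -- The test vector is the cross product `p × u`, for which `det (p, u, p × u) = |p × u|² =
  -- |p|²|u|² - ⟨p, u⟩²`.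
  have h1 := h !₂[p 1 * u 2 - p 2 * u 1, p 2 * u 0 - p 0 * u 2, p 0 * u 1 - p 1 * u 0]
    (by rw [inner_R3]; simp; ring)
  rw [areaForm_apply, mul_eq_zero, or_iff_right (inv_ne_zero r.2.ne')] at h1
  rw [inner_R3] at hp hu
  simp at h1
  have hr := r.2
  have h2 : r.1 ^ 2 * (u 0 ^ 2 + u 1 ^ 2 + u 2 ^ 2) = 0 := by
    rw [← hp]
    linear_combination h1 + (p 0 * u 0 + p 1 * u 1 + p 2 * u 2) * hu
  have h3 : u 0 ^ 2 + u 1 ^ 2 + u 2 ^ 2 = 0 := by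
    rcases mul_eq_zero.1 h2 with h | h
    · exact absurd h (by positivity)
    · exact h
  apply R3_ext <;> simp <;> nlinarith [sq_nonneg (u 0), sq_nonneg (u 1), sq_nonneg (u 2)]

/-- Three vectors in the plane orthogonal to `p` are dependent. The proof is Cramer's identity:
`|p|² det (u, v, w)` is a combination of `⟨p, u⟩`, `⟨p, v⟩`, `⟨p, w⟩`. -/
theorem det3_eq_zero_of_orthogonal {p : R3} (hp : inner ℝ p p ≠ 0) {u v w : R3}
    (hu : inner ℝ p u = 0) (hv : inner ℝ p v = 0) (hw : inner ℝ p w = 0) :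
    det3 ![u, v, w] = 0 := by
  rw [inner_R3] at *
  rw [det3_apply]
  refine (mul_eq_zero.1 ?_).resolve_left hp
  linear_combination
    (p 0 * (v 1 * w 2 - v 2 * w 1) - p 1 * (v 0 * w 2 - v 2 * w 0) +
      p 2 * (v 0 * w 1 - v 1 * w 0)) * hu -
    (p 0 * (u 1 * w 2 - u 2 * w 1) - p 1 * (u 0 * w 2 - u 2 * w 0) +
      p 2 * (u 0 * w 1 - u 1 * w 0)) * hv +
    (p 0 * (u 1 * v 2 - u 2 * v 1) - p 1 * (u 0 * v 2 - u 2 * v 0) +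
      p 2 * (u 0 * v 1 - u 1 * v 0)) * hw

theorem areaForm_neg (r : Radius) (p u w : R3) :
    areaForm r (-p) ![-u, -w] = -areaForm r p ![u, w] := by
  simp only [areaForm_apply, PiLp.neg_apply]
  ring

/-- `areaForm r` as a linear map in the base point. -/
def areaFormCLM (r : Radius) : R3 →L[ℝ] R3 [⋀^Fin 2]→L[ℝ] ℝ :=
  LinearMap.toContinuousLinearMap
    { toFun := areaForm r
      map_add' := fun p q => by
        ext v
        simp only [areaForm, smul_add, map_add]
      map_smul' := fun c p => by
        ext v
        simp only [areaForm, smul_comm _ c, map_smul, RingHom.id_apply] }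

/-- `areaForm r` is linear in the base point, so it is its own derivative. It is not closed on `ℝ³`;
only its restriction to the spheres is. -/
theorem extDeriv_areaForm (r : Radius) (p u v w : R3) :
    extDeriv (areaForm r) p ![u, v, w] = 3 * r.1⁻¹ * det3 ![u, v, w] := by
  have h : HasFDerivAt (areaForm r) (areaFormCLM r) p := (areaFormCLM r).hasFDerivAt
  rw [extDeriv, h.fderiv, ContinuousAlternatingMap.alternatizeUncurryFin_apply]
  have h3 : ∀ i : Fin 3, areaFormCLM r (![u, v, w] i) (i.removeNth ![u, v, w]) =
      areaForm r (![u, v, w] i) ![i.removeNth ![u, v, w] 0, i.removeNth ![u, v, w] 1] :=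
    fun i => alternating_apply_pair _ _
  refine (Finset.sum_congr rfl fun i _ => congrArg _ (h3 i)).trans ?_
  refine (Fin.sum_univ_three _).trans ?_
  simp [Fin.removeNth, areaForm_apply, det3_apply, Fin.succAbove]
  ring

end Area

/-! ## Smooth maps into and out of products of spheres -/

section Coord

variable {m : ℕ} (r : Fin m → Radius)

theorem inner_coord_self (i : Fin m) (x : SphereProduct r) :
    inner ℝ (coord r i x) (coord r i x) = (r i).1 ^ 2 := by
  rw [real_inner_self_eq_norm_sq, coord, mem_sphere_zero_iff_norm.1 (x i).2]

theorem ext_coord {x y : SphereProduct r} (h : ∀ i, coord r i x = coord r i y) : x = y :=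
  funext fun i => Subtype.ext (h i)

/-- The chart `sphereChart r v` as a function on `ℝ³`. -/
def extendedStereographic (r : Radius) (v : Metric.sphere (0 : R3) 1) (p : R3) :
    EuclideanSpace ℝ (Fin 2) :=
  (OrthonormalBasis.fromOrthogonalSpanSingleton 2 (ne_zero_of_mem_unit_sphere v)).repr
    (stereoToFun (v : R3) (r.1⁻¹ • p))

theorem contDiffAt_extendedStereographic (r : Radius) (v : Metric.sphere (0 : R3) 1) {p : R3}
    (h : inner ℝ (v : R3) (r.1⁻¹ • p) ≠ 1) :
    ContDiffAt ℝ ∞ (extendedStereographic r v) p := by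
  have h1 : ContDiffAt ℝ ∞ (stereoToFun (v : R3)) (r.1⁻¹ • p) :=
    contDiffOn_stereoToFun.contDiffAt <|
      (isOpen_ne_fun (innerSL ℝ (v : R3)).continuous continuous_const).mem_nhds h
  exact (LinearIsometryEquiv.contDiff _).contDiffAt.comp p
    (h1.comp p (contDiff_const_smul _).contDiffAt)

theorem inner_ne_one_of_mem_source {v : Fin m → Metric.sphere (0 : R3) 1} {x : SphereProduct r}
    (hx : x ∈ (productChart r v).source) (i : Fin m) :
    inner ℝ (v i : R3) ((r i).1⁻¹ • coord r i x) ≠ 1 := by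
  have h : toUnit (r i) (x i) ∈ (stereographic' 2 (v i)).source := (hx i (mem_univ i)).2
  rw [stereographic'_source] at h
  intro h1
  exact h ((sphere_ext_iff (v i) (toUnit (r i) (x i))).2 h1).symm

/-- The formula for the inverse stereographic projection is smooth on the whole model space, so no
restriction to the target is needed. -/
theorem contDiff_coord_productChart_symm (v : Fin m → Metric.sphere (0 : R3) 1) (i : Fin m) :
    ContDiff ℝ ∞ (coord r i ∘ (productChart r v).symm) := by
  have h : coord r i ∘ (productChart r v).symm = fun y : ModelSpace m =>
      (r i).1 • stereoInvFunAux (v i : R3)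
        (((OrthonormalBasis.fromOrthogonalSpanSingleton 2
          (ne_zero_of_mem_unit_sphere (v i))).repr.symm (y i) : (ℝ ∙ (v i : R3))ᗮ) : R3) := rfl
  rw [h]
  let U := (OrthonormalBasis.fromOrthogonalSpanSingleton (𝕜 := ℝ) 2
    (ne_zero_of_mem_unit_sphere (v i))).repr
  have h1 : ContDiff ℝ ∞ fun y : ModelSpace m => U.symm (y i) :=
    U.symm.contDiff.comp (contDiff_apply ℝ _ i)
  have h2 : ContDiff ℝ ∞ fun y : ModelSpace m => (U.symm (y i) : R3) :=
    (ℝ ∙ (v i : R3))ᗮ.subtypeL.contDiff.comp h1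
  exact (contDiff_const_smul (r i).1).comp
    ((contDiff_stereoInvFunAux (v := (v i : R3)) (m := ∞)).comp h2)

theorem contMDiff_coord (i : Fin m) :
    ContMDiff 𝓘(ℝ, ModelSpace m) 𝓘(ℝ, R3) ∞ (coord r i) := by
  intro x
  let v : Fin m → Metric.sphere (0 : R3) 1 := fun i => -toUnit (r i) (x i)
  have h1 : ContMDiffAt 𝓘(ℝ, ModelSpace m) 𝓘(ℝ, ModelSpace m) ∞ (productChart r v) x :=
    contMDiffAt_of_mem_maximalAtlas (IsManifold.chart_mem_maximalAtlas x)
      (mem_chart_source (ModelSpace m) x)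
  have h2 := (contDiff_coord_productChart_symm r v i).contMDiff.contMDiffAt.comp x h1
  refine h2.congr_of_eventuallyEq ?_
  filter_upwards [(chartAt (ModelSpace m) x).open_source.mem_nhds
    (mem_chart_source (ModelSpace m) x)] with y hy
  exact congrArg (coord r i) ((chartAt (ModelSpace m) x).left_inv hy).symm

-- Each chart is the restriction of `extendedStereographic`, which is smooth near the point in `ℝ³`;
-- composing with it turns smooth ambient coordinates into smooth chart coordinates.
variable {r} in
theorem contMDiff_of_coord {E' H' N : Type*} [NormedAddCommGroup E'] [NormedSpace ℝ E']
    [TopologicalSpace H'] {I : ModelWithCorners ℝ E' H'} [TopologicalSpace N] [ChartedSpace H' N]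
    {f : N → SphereProduct r}
    (h : ∀ i, ContMDiff I 𝓘(ℝ, R3) ∞ fun x => coord r i (f x)) :
    ContMDiff I 𝓘(ℝ, ModelSpace m) ∞ f := by
  have hcont : Continuous f := by
    refine continuous_pi (A := fun i => RoundSphere (r i)) fun i => ?_
    exact Continuous.subtype_mk (h i).continuous _
  intro x
  rw [contMDiffAt_iff_target]
  refine ⟨hcont.continuousAt, ?_⟩
  rw [contMDiffAt_pi_space]
  intro i
  have h1 := contDiffAt_extendedStereographic (r i) _
    (inner_ne_one_of_mem_source r (mem_chart_source (ModelSpace m) (f x)) i)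
  exact h1.contMDiffAt.comp (f := fun x => coord r i (f x)) x (h i x)

theorem contDiffOn_coord_symm {e : OpenPartialHomeomorph (SphereProduct r) (ModelSpace m)}
    (he : e ∈ IsManifold.maximalAtlas 𝓘(ℝ, ModelSpace m) ∞ (SphereProduct r)) (i : Fin m) :
    ContDiffOn ℝ ∞ (coord r i ∘ e.symm) e.target :=
  contMDiffOn_iff_contDiffOn.1
    ((contMDiff_coord r i).comp_contMDiffOn (contMDiffOn_symm_of_mem_maximalAtlas he))

theorem mdifferentiableAt_coord (i : Fin m) (x : SphereProduct r) :
    MDifferentiableAt 𝓘(ℝ, ModelSpace m) 𝓘(ℝ, R3) (coord r i) x :=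
  (contMDiff_coord r i).mdifferentiableAt (by simp)

theorem mvfderiv_coord_comp {E' H' N : Type*} [NormedAddCommGroup E'] [NormedSpace ℝ E']
    [TopologicalSpace H'] {I : ModelWithCorners ℝ E' H'} [TopologicalSpace N] [ChartedSpace H' N]
    {f : N → SphereProduct r} {x : N}
    (hf : MDifferentiableAt I 𝓘(ℝ, ModelSpace m) f x) (i : Fin m) :
    mvfderiv I (fun y => coord r i (f y)) x =
      (mvfderiv 𝓘(ℝ, ModelSpace m) (coord r i) (f x)).comp (mfderiv I 𝓘(ℝ, ModelSpace m) f x) :=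
  mfderiv_comp x (mdifferentiableAt_coord r i (f x)) hf

theorem mvfderiv_eq_fderiv' {E' F' : Type*} [NormedAddCommGroup E'] [NormedSpace ℝ E']
    [NormedAddCommGroup F'] [NormedSpace ℝ F'] (f : E' → F') (x : E') :
    mvfderiv 𝓘(ℝ, E') f x = fderiv ℝ f x := by
  ext u
  rw [mvfderiv, mfderiv_eq_fderiv]
  rfl

theorem productForm_apply (x : SphereProduct r) (u v : TangentSpace 𝓘(ℝ, ModelSpace m) x) :
    productForm r x ![u, v] = ∑ i, areaForm (r i) (coord r i x)
      ![mvfderiv 𝓘(ℝ, ModelSpace m) (coord r i) x u,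
        mvfderiv 𝓘(ℝ, ModelSpace m) (coord r i) x v] := by
  have h : ∀ α : Fin m → TangentSpace 𝓘(ℝ, ModelSpace m) x [⋀^Fin 2]→L[ℝ] ℝ,
      (∑ i, α i) ![u, v] = ∑ i, α i ![u, v] := fun α =>
    ContinuousAlternatingMap.sum_apply _ _
  refine (h _).trans (Finset.sum_congr rfl fun i _ => ?_)
  refine congrArg (areaForm (r i) (coord r i x)) ?_
  ext j : 1
  fin_cases j <;> rfl

/-- By the chain rule, the local form involves only derivatives between normed spaces, so smoothness
and closedness become ordinary calculus. -/
theorem localForm_productForm {e : OpenPartialHomeomorph (SphereProduct r) (ModelSpace m)}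
    (he : e ∈ IsManifold.maximalAtlas 𝓘(ℝ, ModelSpace m) ∞ (SphereProduct r))
    {y : ModelSpace m} (hy : y ∈ e.target) :
    localForm (productForm r) e y = ∑ i, (areaForm (r i) ((coord r i ∘ e.symm) y)).compContinuousLinearMap
      (fderiv ℝ (coord r i ∘ e.symm) y) := by
  have hd : MDifferentiableAt 𝓘(ℝ, ModelSpace m) 𝓘(ℝ, ModelSpace m) e.symm y :=
    (contMDiffAt_symm_of_mem_maximalAtlas he hy).mdifferentiableAt (by simp)
  ext w
  rw [alternating_apply_pair, alternating_apply_pair _ w, ContinuousAlternatingMap.sum_apply]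
  have h1 := productForm_apply r (e.symm y)
    (mfderiv 𝓘(ℝ, ModelSpace m) 𝓘(ℝ, ModelSpace m) e.symm y (w 0))
    (mfderiv 𝓘(ℝ, ModelSpace m) 𝓘(ℝ, ModelSpace m) e.symm y (w 1))
  refine Eq.trans ?_ (h1.trans (Finset.sum_congr rfl fun i _ => ?_))
  · refine congrArg (productForm r (e.symm y)) ?_
    ext j : 1
    fin_cases j <;> rfl
  · have h2 := mvfderiv_coord_comp r hd i
    rw [mvfderiv_eq_fderiv'] at h2
    rw [show coord r i ∘ e.symm = fun y => coord r i (e.symm y) from rfl, h2]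
    refine congrArg (areaForm (r i) (coord r i (e.symm y))) ?_
    ext j : 1
    fin_cases j <;> rfl

theorem mvfderiv_coord_eq (i : Fin m) (x : SphereProduct r) :
    mvfderiv 𝓘(ℝ, ModelSpace m) (coord r i) x =
      fderiv ℝ (coord r i ∘ (chartAt (ModelSpace m) x).symm) (chartAt (ModelSpace m) x x) := by
  ext u
  rw [mvfderiv, (mdifferentiableAt_coord r i x).mfderiv]
  simp only [mfld_simps]
  rw [fderivWithin_univ]
  rfl

end Coord

/-! ## The symplectic manifold -/

section Symplectic

variable {m : ℕ} (r : Fin m → Radius)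

theorem inner_fderiv_eq_zero {E : Type*} [NormedAddCommGroup E] [NormedSpace ℝ E] {g : E → R3}
    {c : ℝ} (hg : ∀ y, inner ℝ (g y) (g y) = c) {y : E} (hd : DifferentiableAt ℝ g y) (u : E) :
    inner ℝ (g y) (fderiv ℝ g y u) = 0 := by
  have h1 := fderiv_inner_apply ℝ hd hd u
  rw [show (fun t => inner ℝ (g t) (g t)) = fun _ => c from funext hg, fderiv_fun_const] at h1
  rw [real_inner_comm (g y)] at h1
  have h2 : (0 : ℝ) = inner ℝ (g y) (fderiv ℝ g y u) + inner ℝ (g y) (fderiv ℝ g y u) := h1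
  linarith

theorem inner_mvfderiv_coord (i : Fin m) (x : SphereProduct r)
    (u : TangentSpace 𝓘(ℝ, ModelSpace m) x) :
    inner ℝ (coord r i x) (mvfderiv 𝓘(ℝ, ModelSpace m) (coord r i) x u) = 0 := by
  rw [mvfderiv_coord_eq]
  have h := inner_fderiv_eq_zero (g := coord r i ∘ (chartAt (ModelSpace m) x).symm)
    (fun y => inner_coord_self r i _)
    ((contDiff_coord_productChart_symm r _ i).differentiable (by simp)
      (chartAt (ModelSpace m) x x)) u
  rwa [Function.comp_apply, (chartAt (ModelSpace m) x).left_inv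
    (mem_chart_source (ModelSpace m) x)] at h

/-- The embedding is an immersion: stereographic projection, extended to `ℝ³`, is a smooth left
inverse of the parametrization, so the derivative of the latter is injective. -/
theorem eq_zero_of_mvfderiv_coord_eq_zero (x : SphereProduct r)
    (u : TangentSpace 𝓘(ℝ, ModelSpace m) x)
    (h : ∀ i, mvfderiv 𝓘(ℝ, ModelSpace m) (coord r i) x u = 0) : u = 0 := by
  let v : Fin m → Metric.sphere (0 : R3) 1 := fun i => -toUnit (r i) (x i)
  have hx : x ∈ (productChart r v).source := mem_chart_source (ModelSpace m) x
  refine funext fun i => ?_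
  have h1 := h i
  rw [mvfderiv_coord_eq] at h1
  let y := productChart r v x
  let g : ModelSpace m → R3 := coord r i ∘ (productChart r v).symm
  have hg : HasFDerivAt g (fderiv ℝ g y) y :=
    ((contDiff_coord_productChart_symm r v i).differentiable (by simp) y).hasFDerivAt
  have hgy : g y = coord r i x := congrArg (coord r i) ((productChart r v).left_inv hx)
  have hΦ : DifferentiableAt ℝ (extendedStereographic (r i) (v i)) (g y) := by
    rw [hgy]
    exact (contDiffAt_extendedStereographic (r i) (v i)
      (inner_ne_one_of_mem_source r hx i)).differentiableAt (by simp)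
  have hcomp := hΦ.hasFDerivAt.comp y hg
  have hid : extendedStereographic (r i) (v i) ∘ g =ᶠ[nhds y] fun z => z i := by
    filter_upwards [(productChart r v).open_target.mem_nhds ((productChart r v).map_source hx)]
      with z hz
    exact congrFun ((productChart r v).right_inv hz) i
  have h3 := (hcomp.congr_of_eventuallyEq hid.symm).unique
    (ContinuousLinearMap.proj (R := ℝ) (φ := fun _ : Fin m => EuclideanSpace ℝ (Fin 2)) i).hasFDerivAt
  have h4 := DFunLike.congr_fun h3 u
  have h5 : fderiv ℝ g y u = 0 := h1
  have h6 : fderiv ℝ (extendedStereographic (r i) (v i)) (g y) (fderiv ℝ g y u) = u i := h4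
  rw [h5, map_zero] at h6
  exact h6.symm

/-- The differential of the embedding in `(ℝ³)ᵐ`, with values in the tangent planes. -/
def tangentMap (x : SphereProduct r) :
    ModelSpace m →ₗ[ℝ] ∀ i, (ℝ ∙ coord r i x)ᗮ where
  toFun u i := ⟨mvfderiv 𝓘(ℝ, ModelSpace m) (coord r i) x u,
    Submodule.mem_orthogonal_singleton_iff_inner_right.2 (inner_mvfderiv_coord r i x u)⟩
  map_add' _ _ := funext fun _ => Subtype.ext (map_add _ _ _)
  map_smul' _ _ := funext fun _ => Subtype.ext (map_smul _ _ _)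

/-- The injective `tangentMap` goes between spaces of the same dimension `2 * m`, so it is onto. -/
theorem exists_mvfderiv_coord_eq (x : SphereProduct r) (w : Fin m → R3)
    (hw : ∀ i, inner ℝ (coord r i x) (w i) = 0) :
    ∃ u : TangentSpace 𝓘(ℝ, ModelSpace m) x,
      ∀ i, mvfderiv 𝓘(ℝ, ModelSpace m) (coord r i) x u = w i := by
  have hne : ∀ i, coord r i x ≠ 0 := fun i h => by
    have h1 := inner_coord_self r i x
    rw [h, inner_zero_left] at h1
    exact (pow_pos (r i).2 2).ne h1
  have hinj : Function.Injective (tangentMap r x) := by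
    rw [← LinearMap.ker_eq_bot, LinearMap.ker_eq_bot']
    intro u hu
    exact eq_zero_of_mvfderiv_coord_eq_zero r x u fun i => congrArg Subtype.val (congrFun hu i)
  have hdim : finrank ℝ (ModelSpace m) = finrank ℝ (∀ i, (ℝ ∙ coord r i x)ᗮ) := by
    rw [finrank_modelSpace, Module.finrank_pi_fintype]
    simp only [fun i => Submodule.finrank_orthogonal_span_singleton (𝕜 := ℝ) (n := 2) (hne i)]
    simp [mul_comm]
  obtain ⟨u, hu⟩ := (LinearMap.injective_iff_surjective_of_finrank_eq_finrank hdim).1 hinj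
    fun i => ⟨w i, Submodule.mem_orthogonal_singleton_iff_inner_right.2 (hw i)⟩
  exact ⟨u, fun i => congrArg Subtype.val (congrFun hu i)⟩

theorem productForm_nondegenerate (x : SphereProduct r)
    (u : TangentSpace 𝓘(ℝ, ModelSpace m) x)
    (hu : ∀ v : TangentSpace 𝓘(ℝ, ModelSpace m) x, productForm r x ![u, v] = 0) : u = 0 := by
  refine eq_zero_of_mvfderiv_coord_eq_zero r x u fun i => ?_
  refine areaForm_nondegenerate (r i) (inner_coord_self r i x) (inner_mvfderiv_coord r i x u)
    fun w hw => ?_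
  -- A tangent vector that moves only the `i`-th factor isolates the `i`-th summand of the form.
  obtain ⟨v, hv⟩ := exists_mvfderiv_coord_eq r x (Pi.single i w) fun j => by
    by_cases hj : j = i
    · subst hj; simpa using hw
    · simp [hj]
  have h := hu v
  rw [productForm_apply, Finset.sum_eq_single i] at h
  · rwa [hv, Pi.single_eq_same] at h
  · intro j _ hj
    rw [hv, Pi.single_eq_of_ne hj, areaForm_apply]
    simp
  · simp

/-- Evaluation on pairs of basis vectors is an injective linear map to a space of matrices. Its
linear left inverse recovers the form smoothly from its values. -/
theorem contDiffOn_alternating_of_apply {E X : Type*} [NormedAddCommGroup E] [NormedSpace ℝ E]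
    [FiniteDimensional ℝ E] [NormedAddCommGroup X] [NormedSpace ℝ X]
    {f : X → E [⋀^Fin 2]→L[ℝ] ℝ} {s : Set X} {k : ℕ∞ω}
    (h : ∀ u v, ContDiffOn ℝ k (fun x => f x ![u, v]) s) : ContDiffOn ℝ k f s := by
  let b := finBasis ℝ E
  let T : (E [⋀^Fin 2]→L[ℝ] ℝ) →ₗ[ℝ] (Fin (finrank ℝ E) → Fin (finrank ℝ E) → ℝ) :=
    { toFun := fun α i j => α ![b i, b j]
      map_add' := fun α β => rfl
      map_smul' := fun c α => rfl }
  have hT : T.ker = ⊥ := by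
    rw [LinearMap.ker_eq_bot']
    intro α hα
    apply ContinuousAlternatingMap.toAlternatingMap_injective
    refine Basis.ext_alternating b fun v _ => ?_
    exact (alternating_apply_pair α _).trans (congrFun (congrFun hα (v 0)) (v 1))
  obtain ⟨S, hS⟩ := T.exists_leftInverse_of_injective hT
  have h1 : ContDiffOn ℝ k (fun x => T (f x)) s :=
    contDiffOn_pi.2 fun i => contDiffOn_pi.2 fun j => h _ _
  have h2 := (LinearMap.toContinuousLinearMap S).contDiff.comp_contDiffOn h1
  refine h2.congr fun x _ => ?_
  exact (DFunLike.congr_fun hS (f x)).symm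

theorem contDiffOn_localForm {e : OpenPartialHomeomorph (SphereProduct r) (ModelSpace m)}
    (he : e ∈ IsManifold.maximalAtlas 𝓘(ℝ, ModelSpace m) ∞ (SphereProduct r)) :
    ContDiffOn ℝ ∞ (localForm (productForm r) e) e.target := by
  refine contDiffOn_alternating_of_apply fun u v => ?_
  refine ContDiffOn.congr (f := fun y => ∑ i, areaForm (r i) ((coord r i ∘ e.symm) y)
    ![fderiv ℝ (coord r i ∘ e.symm) y u, fderiv ℝ (coord r i ∘ e.symm) y v]) ?_ fun y hy => ?_
  · refine ContDiffOn.sum fun i _ => ?_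
    have h0 := contDiffOn_coord_symm r he i
    have h1 : ∀ w, ContDiffOn ℝ ∞ (fun y => fderiv ℝ (coord r i ∘ e.symm) y w) e.target :=
      fun w => (h0.fderiv_of_isOpen e.open_target (by simp)).clm_apply contDiffOn_const
    have h0' := (contDiffOn_piLp 2).1 h0
    have h1' := fun w => (contDiffOn_piLp 2).1 (h1 w)
    simp only [areaForm_apply]
    exact contDiffOn_const.mul ((((h0' 0).mul (((h1' u 1).mul (h1' v 2)).sub
      ((h1' u 2).mul (h1' v 1)))).sub ((h0' 1).mul (((h1' u 0).mul (h1' v 2)).sub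
      ((h1' u 2).mul (h1' v 0))))).add ((h0' 2).mul (((h1' u 0).mul (h1' v 1)).sub
      ((h1' u 1).mul (h1' v 0)))))
  · rw [localForm_productForm r he hy, ContinuousAlternatingMap.sum_apply]
    refine Finset.sum_congr rfl fun i _ => ?_
    exact alternating_apply_pair _ _

/-- The exterior derivative commutes with pull-back, and that of the area form is a multiple of
`det3`. Derivatives of a map into the sphere are orthogonal to the position, so `det3` vanishes on
three of them. -/
theorem extDeriv_localForm {e : OpenPartialHomeomorph (SphereProduct r) (ModelSpace m)}
    (he : e ∈ IsManifold.maximalAtlas 𝓘(ℝ, ModelSpace m) ∞ (SphereProduct r))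
    {y : ModelSpace m} (hy : y ∈ e.target) :
    extDeriv (localForm (productForm r) e) y = 0 := by
  have hev : localForm (productForm r) e =ᶠ[nhds y] fun y => ∑ i,
      (areaForm (r i) ((coord r i ∘ e.symm) y)).compContinuousLinearMap
        (fderiv ℝ (coord r i ∘ e.symm) y) := by
    filter_upwards [e.open_target.mem_nhds hy] with z hz using localForm_productForm r he hz
  have hc : ∀ i, ContDiffAt ℝ ∞ (coord r i ∘ e.symm) y := fun i =>
    (contDiffOn_coord_symm r he i).contDiffAt (e.open_target.mem_nhds hy)
  have hA : ∀ i p, DifferentiableAt ℝ (areaForm (r i)) p := fun i p =>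
    (areaFormCLM (r i)).differentiableAt
  have hdiff : ∀ i, DifferentiableAt ℝ (fun y =>
      (areaForm (r i) ((coord r i ∘ e.symm) y)).compContinuousLinearMap
        (fderiv ℝ (coord r i ∘ e.symm) y)) y := fun i => by
    refine DifferentiableAt.continuousAlternatingMapCompContinuousLinearMap ?_ ?_
    · exact (hA i _).comp y ((hc i).differentiableAt (by simp))
    · exact ((hc i).fderiv_right (m := ∞) (by simp)).differentiableAt (by simp)
  rw [hev.extDeriv_eq, extDeriv, fderiv_fun_sum fun i _ => hdiff i]
  have hzero : ∀ i, extDeriv (fun y =>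
      (areaForm (r i) ((coord r i ∘ e.symm) y)).compContinuousLinearMap
        (fderiv ℝ (coord r i ∘ e.symm) y)) y = 0 := fun i => by
    rw [extDeriv_pullback (hA i _) (hc i) (by simpa using ENat.LEInfty.out)]
    ext w
    have h1 : ∀ u, inner ℝ ((coord r i ∘ e.symm) y) (fderiv ℝ (coord r i ∘ e.symm) y u) = 0 :=
      inner_fderiv_eq_zero (fun z => inner_coord_self r i _) ((hc i).differentiableAt (by simp))
    have h2 : ∀ (z : Fin 3 → R3), z = ![z 0, z 1, z 2] := fun z => by
      ext j : 1; fin_cases j <;> rfl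
    rw [ContinuousAlternatingMap.compContinuousLinearMap_apply, h2 (_ ∘ w), extDeriv_areaForm]
    simp only [Function.comp_apply]
    rw [det3_eq_zero_of_orthogonal (p := (coord r i ∘ e.symm) y) ?_ (h1 _) (h1 _) (h1 _)]
    · simp
    · rw [Function.comp_apply, inner_coord_self]
      exact (pow_pos (r i).2 2).ne'
  have hsum := map_sum (ContinuousAlternatingMap.alternatizeUncurryFinCLM (n := 2) ℝ (ModelSpace m) ℝ)
    (fun i => fderiv ℝ (fun y =>
      (areaForm (r i) ((coord r i ∘ e.symm) y)).compContinuousLinearMap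
        (fderiv ℝ (coord r i ∘ e.symm) y)) y) Finset.univ
  exact hsum.trans (Finset.sum_eq_zero fun i _ => hzero i)

instance : CompactSpace (SphereProduct r) :=
  inferInstanceAs (CompactSpace (∀ i, RoundSphere (r i)))

instance : T2Space (SphereProduct r) :=
  inferInstanceAs (T2Space (∀ i, RoundSphere (r i)))

theorem isClosedSymplecticManifold_productForm :
    IsClosedSymplecticManifold m (productForm r) where
  isManifold := inferInstance
  compactSpace := inferInstance
  t2Space := inferInstance
  finrank_eq := finrank_modelSpace m
  finiteDimensional := inferInstance
  smooth _ he := contDiffOn_localForm r he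
  closed _ he _ hy := extDeriv_localForm r he hy
  nondegenerate := productForm_nondegenerate r

end Symplectic

/-! ## The circle action by rotations -/

section Action

/-- The rotation of `ℝ³` by the angle `θ` about the third axis. -/
def rotZ (θ : ℝ) : R3 →L[ℝ] R3 :=
  LinearMap.toContinuousLinearMap
    { toFun := fun p => !₂[Real.cos θ * p 0 - Real.sin θ * p 1,
        Real.sin θ * p 0 + Real.cos θ * p 1, p 2]
      map_add' := fun p q => by apply R3_ext <;> simp <;> ring
      map_smul' := fun a p => by apply R3_ext <;> simp <;> ring }

@[simp] theorem rotZ_apply_zero (θ : ℝ) (p : R3) :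
    rotZ θ p 0 = Real.cos θ * p 0 - Real.sin θ * p 1 := rfl

@[simp] theorem rotZ_apply_one (θ : ℝ) (p : R3) :
    rotZ θ p 1 = Real.sin θ * p 0 + Real.cos θ * p 1 := rfl

@[simp] theorem rotZ_apply_two (θ : ℝ) (p : R3) : rotZ θ p 2 = p 2 := rfl

theorem inner_rotZ (θ : ℝ) (p q : R3) : inner ℝ (rotZ θ p) (rotZ θ q) = inner ℝ p q := by
  simp only [inner_R3, rotZ_apply_zero, rotZ_apply_one, rotZ_apply_two]
  linear_combination (p 0 * q 0 + p 1 * q 1) * Real.sin_sq_add_cos_sq θ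

theorem rotZ_zero (p : R3) : rotZ 0 p = p := by
  apply R3_ext <;> simp

theorem rotZ_add (s t : ℝ) (p : R3) : rotZ (s + t) p = rotZ s (rotZ t p) := by
  apply R3_ext <;> simp [Real.cos_add, Real.sin_add] <;> ring

theorem rotZ_int_mul_two_pi (k : ℤ) (p : R3) : rotZ (k * (2 * Real.pi)) p = p := by
  have h : Real.sin (k * (2 * Real.pi)) = 0 := by
    simpa using Real.sin_add_int_mul_two_pi 0 k
  apply R3_ext <;> simp [Real.cos_int_mul_two_pi, h]

theorem contDiff_rotZ : ContDiff ℝ ∞ fun q : ℝ × R3 => rotZ q.1 q.2 := by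
  have h : ∀ i, ContDiff ℝ ∞ fun q : ℝ × R3 => q.2 i := fun i =>
    (contDiff_piLp 2).1 contDiff_snd i
  have hc : ContDiff ℝ ∞ fun q : ℝ × R3 => Real.cos q.1 := Real.contDiff_cos.comp contDiff_fst
  have hs : ContDiff ℝ ∞ fun q : ℝ × R3 => Real.sin q.1 := Real.contDiff_sin.comp contDiff_fst
  refine contDiff_piLp' 2 fun i => ?_
  fin_cases i
  · exact (hc.mul (h 0)).sub (hs.mul (h 1))
  · exact (hs.mul (h 0)).add (hc.mul (h 1))
  · exact h 2

/-- The vector `e₃ × p`. -/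
def crossZ (p : R3) : R3 := !₂[-p 1, p 0, 0]

theorem hasDerivAt_rotZ (a t : ℝ) (p : R3) :
    HasDerivAt (fun τ => rotZ (a * τ) p) (a • crossZ (rotZ (a * t) p)) t := by
  have hl : HasDerivAt (fun τ => a * τ) a t := by simpa using (hasDerivAt_id t).const_mul a
  have hc := hl.cos
  have hs := hl.sin
  -- The orbit is split into a circle in the horizontal plane and a constant vertical part.
  have h : (fun τ => rotZ (a * τ) p) = fun τ =>
      (Real.cos (a * τ) • !₂[p 0, p 1, 0] + Real.sin (a * τ) • crossZ p + !₂[0, 0, p 2] : R3) := by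
    ext1 τ
    apply R3_ext <;> simp [crossZ]
    · ring
    · ring
  rw [h]
  refine (((hc.smul_const _).add (hs.smul_const _)).add_const _).congr_deriv ?_
  apply R3_ext <;> simp [crossZ] <;> ring

/-- By the triple product expansion `p × (e₃ × p) = |p|² e₃ - p₂ p`, whose second term is killed by
`w`. So rotation about the axis is dual to the height, and the sign convention forces the minus sign
in `rotationAction`. -/
theorem areaForm_crossZ (r : Radius) {p w : R3} (hp : inner ℝ p p = r.1 ^ 2)
    (hw : inner ℝ p w = 0) (a : ℝ) : areaForm r p ![a • crossZ p, w] = a * r.1 * w 2 := by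
  have hr := r.2.ne'
  rw [inner_R3] at hp hw
  rw [areaForm_apply]
  simp [crossZ]
  field_simp
  linear_combination a * w 2 * hp - a * p 2 * hw

variable {m : ℕ} (r : Fin m → Radius) (c : Fin m → ℤ)

/-- The action of `ℝ/ℤ` that rotates the `i`-th factor `-c i` times. -/
def rotationAction (t : ℝ) (x : SphereProduct r) : SphereProduct r := fun i =>
  ⟨rotZ (-(2 * Real.pi * c i) * t) (coord r i x), by
    have h := inner_rotZ (-(2 * Real.pi * c i) * t) (coord r i x) (coord r i x)
    rw [inner_coord_self, real_inner_self_eq_norm_sq] at h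
    rw [mem_sphere_zero_iff_norm]
    exact (sq_eq_sq₀ (norm_nonneg _) (r i).2.le).1 h⟩

@[simp] theorem coord_rotationAction (i : Fin m) (t : ℝ) (x : SphereProduct r) :
    coord r i (rotationAction r c t x) = rotZ (-(2 * Real.pi * c i) * t) (coord r i x) := rfl

/-- The Hamiltonian `2π ∑ i, c i * r i * h i`. -/
def weightedHeight (x : SphereProduct r) : ℝ :=
  ∑ i, 2 * Real.pi * c i * (r i).1 * height r i x

theorem contMDiff_weightedHeight :
    ContMDiff 𝓘(ℝ, ModelSpace m) 𝓘(ℝ, ℝ) ∞ (weightedHeight r c) := by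
  refine contMDiff_finsetSum fun i _ => ?_
  have h : ContDiff ℝ ∞ fun p : R3 => 2 * Real.pi * c i * (r i).1 * p 2 :=
    contDiff_const.mul ((contDiff_piLp 2).1 contDiff_id 2)
  exact h.contMDiff.comp (contMDiff_coord r i)

theorem mvfderiv_weightedHeight (x : SphereProduct r) (v : TangentSpace 𝓘(ℝ, ModelSpace m) x) :
    mvfderiv 𝓘(ℝ, ModelSpace m) (weightedHeight r c) x v = ∑ i, 2 * Real.pi * c i * (r i).1 *
      mvfderiv 𝓘(ℝ, ModelSpace m) (coord r i) x v 2 := by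
  have hF : MDifferentiableAt 𝓘(ℝ, ModelSpace m) 𝓘(ℝ, ℝ) (weightedHeight r c) x :=
    (contMDiff_weightedHeight r c).mdifferentiableAt (by simp)
  have h1 : mvfderiv 𝓘(ℝ, ModelSpace m) (weightedHeight r c) x =
      fderiv ℝ (weightedHeight r c ∘ (chartAt (ModelSpace m) x).symm)
        (chartAt (ModelSpace m) x x) := by
    ext u
    rw [mvfderiv, hF.mfderiv]
    simp only [mfld_simps]
    rw [fderivWithin_univ]
    rfl
  rw [h1]
  simp only [mvfderiv_coord_eq]
  have hg : ∀ i, HasFDerivAt (coord r i ∘ (chartAt (ModelSpace m) x).symm)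
      (fderiv ℝ (coord r i ∘ (chartAt (ModelSpace m) x).symm) (chartAt (ModelSpace m) x x))
      (chartAt (ModelSpace m) x x) := fun i =>
    ((contDiff_coord_productChart_symm r _ i).differentiable (by simp) _).hasFDerivAt
  have h2 := HasFDerivAt.fun_sum (u := Finset.univ) fun i _ =>
    ((EuclideanSpace.proj (𝕜 := ℝ) (2 : Fin 3)).hasFDerivAt.comp _ (hg i)).const_mul (2 * Real.pi * c i * (r i).1)
  have h3 := DFunLike.congr_fun h2.fderiv v
  refine h3.trans ?_
  exact sum_apply _ _ _

theorem contMDiff_rotationAction :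
    ContMDiff (𝓘(ℝ, ℝ).prod 𝓘(ℝ, ModelSpace m)) 𝓘(ℝ, ModelSpace m) ∞
      (fun p : ℝ × SphereProduct r => rotationAction r c p.1 p.2) := by
  refine contMDiff_of_coord fun i => ?_
  have h1 : ContDiff ℝ ∞ fun t : ℝ => -(2 * Real.pi * c i) * t := contDiff_const.mul contDiff_id
  have h2 : ContMDiff (𝓘(ℝ, ℝ).prod 𝓘(ℝ, ModelSpace m)) 𝓘(ℝ, ℝ × R3) ∞
      (fun p : ℝ × SphereProduct r => (-(2 * Real.pi * c i) * p.1, coord r i p.2)) :=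
    (h1.contMDiff.comp contMDiff_fst).prodMk_space ((contMDiff_coord r i).comp contMDiff_snd)
  have h3 := contDiff_rotZ.contMDiff.comp h2
  exact h3

theorem contMDiff_rotationAction_right (t : ℝ) :
    ContMDiff 𝓘(ℝ, ModelSpace m) 𝓘(ℝ, ModelSpace m) ∞ (rotationAction r c t) :=
  contMDiff_of_coord fun i => (rotZ _).contDiff.contMDiff.comp (contMDiff_coord r i)

theorem contMDiff_rotationAction_left (x : SphereProduct r) :
    ContMDiff 𝓘(ℝ, ℝ) 𝓘(ℝ, ModelSpace m) ∞ fun t => rotationAction r c t x := by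
  refine contMDiff_of_coord fun i => ?_
  have h : ContDiff ℝ ∞ fun t : ℝ => (-(2 * Real.pi * c i) * t, coord r i x) :=
    (contDiff_const.mul contDiff_id).prodMk contDiff_const
  exact (contDiff_rotZ.comp h).contMDiff

theorem mvfderiv_coord_rotationAction_velocity (i : Fin m) (t : ℝ) (x : SphereProduct r) :
    mvfderiv 𝓘(ℝ, ModelSpace m) (coord r i) (rotationAction r c t x)
      (mfderiv 𝓘(ℝ, ℝ) 𝓘(ℝ, ModelSpace m) (fun τ => rotationAction r c τ x) t (1 : ℝ)) =
      -(2 * Real.pi * c i) • crossZ (coord r i (rotationAction r c t x)) := by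
  have h1 := mvfderiv_coord_comp r (x := t)
    ((contMDiff_rotationAction_left r c x).mdifferentiableAt (by simp)) i
  rw [mvfderiv_eq_fderiv'] at h1
  have h2 := DFunLike.congr_fun h1 (1 : ℝ)
  refine Eq.trans h2.symm ?_
  exact (fderiv_eq_smul_deriv ..).trans
    ((one_smul ℝ _).trans (hasDerivAt_rotZ (-(2 * Real.pi * c i)) t (coord r i x)).deriv)

theorem isHamiltonianCircleAction_rotationAction :
    IsHamiltonianCircleAction (productForm r) (weightedHeight r c) (rotationAction r c) where
  smooth_hamiltonian := contMDiff_weightedHeight r c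
  smooth := contMDiff_rotationAction r c
  zero x := ext_coord r fun i => by
    rw [coord_rotationAction, mul_zero, rotZ_zero]
  add s t x := ext_coord r fun i => by
    simp only [coord_rotationAction, mul_add, rotZ_add]
  one x := ext_coord r fun i => by
    rw [coord_rotationAction, show -(2 * Real.pi * c i) * 1 = ((-c i : ℤ) : ℝ) * (2 * Real.pi) by
      push_cast; ring, rotZ_int_mul_two_pi]
  generated t x v := by
    rw [productForm_apply, mvfderiv_weightedHeight, ← Finset.sum_neg_distrib]
    refine Finset.sum_congr rfl fun i _ => ?_
    rw [mvfderiv_coord_rotationAction_velocity, areaForm_crossZ (r i) (inner_coord_self r i _)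
      (inner_mvfderiv_coord r i _ v)]
    ring

end Action

/-! ## The Maslov index at the poles -/

section Maslov

variable {m : ℕ} (r : Fin m → Radius) (c : Fin m → ℤ)

/-- `s` is the point whose `i`-th component is the north or the south pole, according to the
sign `ε i`. -/
structure IsPole (ε : Fin m → ℤ) (s : SphereProduct r) : Prop where
  sign : ∀ i, ε i = 1 ∨ ε i = -1
  coord_eq : ∀ i, coord r i s = !₂[0, 0, ε i * (r i).1]

/-- The differential of the inclusion of the `i`-th factor, on the model space. -/
def coordDeriv (i : Fin m) (x : SphereProduct r) : ModelSpace m →L[ℝ] R3 :=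
  mvfderiv 𝓘(ℝ, ModelSpace m) (coord r i) x

variable {r} {ε : Fin m → ℤ} {s : SphereProduct r}

theorem IsPole.sign_mul_self (hs : IsPole r ε s) (i : Fin m) : (ε i : ℝ) * ε i = 1 := by
  rcases hs.sign i with h | h <;> simp [h]

theorem IsPole.rotZ_coord (hs : IsPole r ε s) (i : Fin m) (θ : ℝ) :
    rotZ θ (coord r i s) = coord r i s := by
  rw [hs.coord_eq]
  apply R3_ext <;> simp

theorem IsPole.rotationAction_eq (hs : IsPole r ε s) (t : ℝ) : rotationAction r c t s = s :=
  ext_coord r fun i => hs.rotZ_coord i _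

/-- Differentiate `coord ∘ f t = rotZ ∘ coord` at the fixed point; the rotation is linear, hence its
own derivative. -/
theorem IsPole.mvfderiv_linearizedLoop (hs : IsPole r ε s) (i : Fin m) (t : ℝ)
    (u : ModelSpace m) :
    coordDeriv r i s (linearizedLoop (rotationAction r c) s t u) =
      rotZ (-(2 * Real.pi * c i) * t) (coordDeriv r i s u) := by
  have h1 := mvfderiv_coord_comp r (x := s)
    ((contMDiff_rotationAction_right r c t).mdifferentiableAt (by simp)) i
  have h2 : coordDeriv r i (rotationAction r c t s) = coordDeriv r i s := by
    rw [hs.rotationAction_eq c t]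
  have h3 := mfderiv_comp s (g := rotZ (-(2 * Real.pi * c i) * t))
    (rotZ (-(2 * Real.pi * c i) * t)).differentiableAt.mdifferentiableAt
    (mdifferentiableAt_coord r i s)
  have h5 : mfderiv 𝓘(ℝ, R3) 𝓘(ℝ, R3) (rotZ (-(2 * Real.pi * c i) * t)) (coord r i s) =
      rotZ (-(2 * Real.pi * c i) * t) := by
    rw [mfderiv_eq_fderiv, ContinuousLinearMap.fderiv]
  have h4 := (DFunLike.congr_fun h1 u).symm.trans (DFunLike.congr_fun h3 u)
  exact (DFunLike.congr_fun h2 (linearizedLoop (rotationAction r c) s t u)).symm.trans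
    (h4.trans (DFunLike.congr_fun h5 (coordDeriv r i s u)))

/-- The coordinates `(d (coord i) u)₀` and `ε i * (d (coord i) u)₁` on the tangent space at a pole. -/
def poleCoordinates (ε : Fin m → ℤ) (s : SphereProduct r) :
    ModelSpace m →ₗ[ℝ] (Fin m ⊕ Fin m → ℝ) where
  toFun u := Sum.elim
    (fun i => coordDeriv r i s u 0)
    (fun i => ε i * coordDeriv r i s u 1)
  map_add' u v := by
    have h : ∀ i, coordDeriv r i s (u + v) =
        coordDeriv r i s u +
          coordDeriv r i s v := fun i => map_add _ _ _
    ext (i | i) <;> simp [h, mul_add]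
  map_smul' a u := by
    have h : ∀ i, coordDeriv r i s (a • u) =
        a • coordDeriv r i s u := fun i => map_smul _ _ _
    ext (i | i) <;> simp [h, mul_left_comm]

theorem poleCoordinates_inl (u : ModelSpace m) (i : Fin m) :
    poleCoordinates ε s u (.inl i) = coordDeriv r i s u 0 := rfl

theorem poleCoordinates_inr (u : ModelSpace m) (i : Fin m) :
    poleCoordinates ε s u (.inr i) = ε i * coordDeriv r i s u 1 := rfl

/-- The tangent plane at a pole is horizontal, so the two horizontal components determine a tangent
vector. -/
theorem IsPole.injective_poleCoordinates (hs : IsPole r ε s) :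
    Function.Injective (poleCoordinates ε s) := by
  rw [← LinearMap.ker_eq_bot, LinearMap.ker_eq_bot']
  intro u hu
  refine eq_zero_of_mvfderiv_coord_eq_zero r s u fun i => ?_
  change coordDeriv r i s u = 0
  have hε := hs.sign_mul_self i
  have h0 := congrFun hu (.inl i)
  have h1 := congrFun hu (.inr i)
  have h2 : inner ℝ (coord r i s) (coordDeriv r i s u) = 0 := inner_mvfderiv_coord r i s u
  rw [poleCoordinates_inl] at h0
  rw [poleCoordinates_inr] at h1
  rw [hs.coord_eq, inner_R3] at h2
  have hε0 : (ε i : ℝ) ≠ 0 := left_ne_zero_of_mul (hε.trans_ne one_ne_zero)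
  have hr : (r i).1 ≠ 0 := (r i).2.ne'
  refine R3_ext h0 ?_ ?_
  · exact (mul_eq_zero.1 h1).resolve_left hε0
  · simpa [hε0, hr] using h2

/-- `poleCoordinates` as a linear equivalence. -/
def IsPole.poleEquiv (hs : IsPole r ε s) : ModelSpace m ≃ₗ[ℝ] (Fin m ⊕ Fin m → ℝ) :=
  LinearMap.linearEquivOfInjective (poleCoordinates ε s) hs.injective_poleCoordinates (by
    rw [finrank_modelSpace]
    simp [two_mul])

theorem IsPole.poleEquiv_apply (hs : IsPole r ε s) (u : ModelSpace m) :
    hs.poleEquiv u = poleCoordinates ε s u := rfl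

/-- The outer normal at the pole is `ε i * e₃`; the sign in the second coordinate absorbs this
orientation and leaves the standard form. -/
theorem IsPole.productForm_apply_eq (hs : IsPole r ε s) (u v : ModelSpace m) :
    (productForm r s : ModelSpace m [⋀^Fin 2]→L[ℝ] ℝ) ![u, v] =
      ∑ i, (poleCoordinates ε s u (.inl i) * poleCoordinates ε s v (.inr i) -
        poleCoordinates ε s u (.inr i) * poleCoordinates ε s v (.inl i)) := by
  refine (productForm_apply r s u v).trans (Finset.sum_congr rfl fun i _ => ?_)
  change areaForm (r i) (coord r i s) ![coordDeriv r i s u, coordDeriv r i s v] = _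
  have hr : (r i).1 ≠ 0 := (r i).2.ne'
  rw [areaForm_apply, hs.coord_eq]
  simp only [poleCoordinates_inl, poleCoordinates_inr]
  simp
  field_simp

theorem IsPole.poleCoordinates_linearizedLoop_inl (hs : IsPole r ε s) (t : ℝ) (u : ModelSpace m)
    (i : Fin m) :
    poleCoordinates ε s (linearizedLoop (rotationAction r c) s t u) (.inl i) =
      Real.cos (ε i * (-(2 * Real.pi * c i) * t)) * poleCoordinates ε s u (.inl i) -
      Real.sin (ε i * (-(2 * Real.pi * c i) * t)) * poleCoordinates ε s u (.inr i) := by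
  simp only [poleCoordinates_inl, poleCoordinates_inr, hs.mvfderiv_linearizedLoop c,
    rotZ_apply_zero]
  rcases hs.sign i with h | h <;> simp [h]

theorem IsPole.poleCoordinates_linearizedLoop_inr (hs : IsPole r ε s) (t : ℝ) (u : ModelSpace m)
    (i : Fin m) :
    poleCoordinates ε s (linearizedLoop (rotationAction r c) s t u) (.inr i) =
      Real.sin (ε i * (-(2 * Real.pi * c i) * t)) * poleCoordinates ε s u (.inl i) +
      Real.cos (ε i * (-(2 * Real.pi * c i) * t)) * poleCoordinates ε s u (.inr i) := by
  simp only [poleCoordinates_inl, poleCoordinates_inr, hs.mvfderiv_linearizedLoop c,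
    rotZ_apply_one]
  rcases hs.sign i with h | h <;> simp [h]
  ring

theorem IsPole.isSymplecticLoop (hs : IsPole r ε s) :
    IsSymplecticLoop (V := ModelSpace m) (productForm r s)
      (linearizedLoop (rotationAction r c) s) where
  continuousOn := by
    refine Continuous.continuousOn (continuous_clm_apply.2 fun u => ?_)
    have h : Continuous fun t => hs.poleEquiv (linearizedLoop (rotationAction r c) s t u) := by
      refine continuous_pi fun k => ?_
      simp only [hs.poleEquiv_apply]
      rcases k with i | i
      · simp only [hs.poleCoordinates_linearizedLoop_inl c]
        fun_prop
      · simp only [hs.poleCoordinates_linearizedLoop_inr c]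
        fun_prop
    have h2 := (LinearMap.continuous_of_finiteDimensional
      (hs.poleEquiv.symm : (Fin m ⊕ Fin m → ℝ) →ₗ[ℝ] ModelSpace m)).comp h
    simpa [Function.comp_def] using h2
  closed := by
    ext1 u
    refine hs.injective_poleCoordinates (funext fun k => ?_)
    have h : ∀ i, (ε i : ℝ) * (-(2 * Real.pi * c i) * 1) = ((-(ε i * c i) : ℤ) : ℝ) * (2 * Real.pi) :=
      fun i => by push_cast; ring
    have hsin : ∀ k : ℤ, Real.sin (k * (2 * Real.pi)) = 0 := fun k => by
      simpa using Real.sin_add_int_mul_two_pi 0 k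
    rcases k with i | i
    · simp only [hs.poleCoordinates_linearizedLoop_inl c, h, hsin, Real.cos_int_mul_two_pi]
      simp
    · simp only [hs.poleCoordinates_linearizedLoop_inr c, h, hsin, Real.cos_int_mul_two_pi]
      simp
  preserves t _ u v := by
    refine (hs.productForm_apply_eq _ _).trans (Eq.trans ?_ (hs.productForm_apply_eq _ _).symm)
    refine Finset.sum_congr rfl fun i _ => ?_
    simp only [hs.poleCoordinates_linearizedLoop_inl c, hs.poleCoordinates_linearizedLoop_inr c]
    linear_combination (poleCoordinates ε s u (.inl i) * poleCoordinates ε s v (.inr i) -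
        poleCoordinates ε s u (.inr i) * poleCoordinates ε s v (.inl i)) *
      Real.sin_sq_add_cos_sq (ε i * (-(2 * Real.pi * c i) * t))

theorem IsPole.isSymplecticBasis (hs : IsPole r ε s) :
    IsSymplecticBasis (V := ModelSpace m) (productForm r s) (Basis.ofEquivFun hs.poleEquiv) := by
  classical
  have hb : ∀ k, poleCoordinates ε s (Basis.ofEquivFun hs.poleEquiv k) = Pi.single k 1 := fun k => by
    rw [← hs.poleEquiv_apply, Basis.coe_ofEquivFun, LinearEquiv.apply_symm_apply]
  intro i j
  refine ⟨(hs.productForm_apply_eq _ _).trans ?_, (hs.productForm_apply_eq _ _).trans ?_,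
    (hs.productForm_apply_eq _ _).trans ?_⟩
  · simp only [hb]
    simp
  · simp only [hb]
    simp
  · simp only [hb]
    simp [Pi.single_apply, eq_comm]

theorem IsPole.hasMaslovIndex_zero (hs : IsPole r ε s) (hc : ∑ i, ε i * c i = 0) :
    HasMaslovIndex (V := ModelSpace m) m (productForm r s)
      (linearizedLoop (rotationAction r c) s) 0 := by
  classical
  -- The loop is already unitary in this basis, so the positive factor is `1`. Its complex
  -- determinant is constantly `1` by `hc`, so the angle `0` works.
  refine ⟨hs.isSymplecticLoop c, Basis.ofEquivFun hs.poleEquiv, hs.isSymplecticBasis, fun _ => 1,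
    fun t => Matrix.diagonal fun i =>
      Complex.exp ((ε i * (-(2 * Real.pi * c i) * t) : ℝ) * Complex.I), fun _ => 0,
    fun t _ => ⟨Matrix.PosDef.one, ?_, ?_, ?_⟩, continuousOn_const, by simp⟩
  · rw [Matrix.mem_unitaryGroup_iff, Matrix.star_eq_conjTranspose, Matrix.diagonal_conjTranspose,
      Matrix.diagonal_mul_diagonal, ← Matrix.diagonal_one]
    congr 1
    ext i
    rw [Pi.star_apply, Complex.star_def, Complex.mul_conj, Complex.normSq_eq_norm_sq,
      Complex.norm_exp_ofReal_mul_I]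
    simp
  · rw [one_mul]
    have hb : ∀ k, poleCoordinates ε s (Basis.ofEquivFun hs.poleEquiv k) = Pi.single k 1 :=
      fun k => by
        rw [← hs.poleEquiv_apply, Basis.coe_ofEquivFun, LinearEquiv.apply_symm_apply]
    ext k l
    rw [LinearMap.toMatrix_apply]
    change poleCoordinates ε s (linearizedLoop (rotationAction r c) s t _) k = _
    rcases k with i | i
    · rw [hs.poleCoordinates_linearizedLoop_inl c, hb]
      rcases l with j | j <;> by_cases hij : i = j <;>
        simp [realify, hij, Complex.exp_ofReal_mul_I_re,
          Complex.exp_ofReal_mul_I_im, -Complex.ofReal_mul, -Complex.ofReal_neg, -neg_mul]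
    · rw [hs.poleCoordinates_linearizedLoop_inr c, hb]
      rcases l with j | j <;> by_cases hij : i = j <;>
        simp [realify, hij, Complex.exp_ofReal_mul_I_re,
          Complex.exp_ofReal_mul_I_im, -Complex.ofReal_mul, -Complex.ofReal_neg, -neg_mul]
  · rw [Matrix.det_diagonal, ← Complex.exp_sum, ← Finset.sum_mul, ← Complex.ofReal_sum]
    have h : ∑ i, (ε i : ℝ) * (-(2 * Real.pi * c i) * t) =
        -(2 * Real.pi) * t * ((∑ i, ε i * c i : ℤ) : ℝ) := by
      push_cast
      rw [Finset.mul_sum]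
      exact Finset.sum_congr rfl fun i _ => by ring
    rw [h, hc]
    simp

theorem IsPole.isMaslovZeroFixedPoint (hs : IsPole r ε s) (hc : ∑ i, ε i * c i = 0) :
    IsMaslovZeroFixedPoint m (productForm r) (rotationAction r c) s :=
  ⟨hs.rotationAction_eq c, hs.hasMaslovIndex_zero c hc⟩

end Maslov

/-! ## The symplectic volume -/

section ChartVolume

theorem measurableSet_preimage_symm_inter_target {X Y : Type*} [TopologicalSpace X]
    [MeasurableSpace X] [BorelSpace X] [TopologicalSpace Y] [MeasurableSpace Y] [BorelSpace Y]
    (e : OpenPartialHomeomorph X Y) {A : Set X}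
    (hA : MeasurableSet A) : MeasurableSet (e.symm ⁻¹' A ∩ e.target) := by
  have h : Measurable (e.target.domRestrict e.symm) :=
    (continuousOn_iff_continuous_domRestrict.1 e.continuousOn_symm).measurable
  have h2 := e.open_target.measurableSet.subtype_image (h hA)
  convert h2 using 1
  ext y
  simp [and_comm]

variable {E : Type*} [NormedAddCommGroup E] [NormedSpace ℝ E] [FiniteDimensional ℝ E]
  [MeasurableSpace E] [BorelSpace E]
  {M : Type*} [TopologicalSpace M] [ChartedSpace E M] [MeasurableSpace M] [BorelSpace M]

/-- The basis of the model space that is used in `chartVolume`. -/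
def chartBasis (n : ℕ) (hE : finrank ℝ E = 2 * n) : Basis (Fin n × Fin 2) ℝ E :=
  (finBasisOfFinrankEq ℝ E (hE.trans (mul_comm 2 n))).reindex finProdFinEquiv.symm

/-- The density of `chartVolume`. -/
def chartDensity (n : ℕ) (hE : finrank ℝ E = 2 * n) (Ω : TwoForm E M)
    (e : OpenPartialHomeomorph M E) (y : E) : ℝ :=
  |wedgePow n (localForm Ω e y) (chartBasis n hE)|

theorem chartVolume_apply (n : ℕ) (hE : finrank ℝ E = 2 * n) (Ω : TwoForm E M)
    (e : OpenPartialHomeomorph M E) {A : Set M} (hA : MeasurableSet A) :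
    chartVolume n hE Ω e A = ∫⁻ y in e.symm ⁻¹' A ∩ e.target,
      ENNReal.ofReal (chartDensity n hE Ω e y) ∂(chartBasis n hE).addHaar := by
  have h1 : AEMeasurable e.symm (((chartBasis n hE).addHaar.restrict e.target).withDensity
      fun y => ENNReal.ofReal (chartDensity n hE Ω e y)) :=
    (e.continuousOn_symm.aemeasurable e.open_target.measurableSet).mono_ac
      (withDensity_absolutelyContinuous _ _)
  have h2 := Measure.map_apply_of_aemeasurable h1 hA
  rw [withDensity_apply', Measure.restrict_restrict' e.open_target.measurableSet] at h2
  exact h2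

theorem chartVolume_inter_source (n : ℕ) (hE : finrank ℝ E = 2 * n) (Ω : TwoForm E M)
    (e : OpenPartialHomeomorph M E) {A : Set M} (hA : MeasurableSet A) :
    chartVolume n hE Ω e (A ∩ e.source) = chartVolume n hE Ω e A := by
  rw [chartVolume_apply n hE Ω e hA,
    chartVolume_apply n hE Ω e (hA.inter e.open_source.measurableSet)]
  congr 2
  ext y
  simp only [mem_inter_iff, mem_preimage]
  exact ⟨fun h => ⟨h.1.1, h.2⟩, fun h => ⟨⟨h.1, e.map_target h.2⟩, h.2⟩⟩

end ChartVolume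

section Volume

variable {m : ℕ} (r : Fin m → Radius)

/-- The measure on the product of spheres given by the top power of the symplectic form. -/
abbrev productVolume : Measure (SphereProduct r) :=
  symplecticVolume m (finrank_modelSpace m) (productForm r)

variable {r} {e e' : OpenPartialHomeomorph (SphereProduct r) (ModelSpace m)}

theorem chartVolume_le_productVolume
    (he : e ∈ IsManifold.maximalAtlas 𝓘(ℝ, ModelSpace m) ∞ (SphereProduct r)) :
    chartVolume m (finrank_modelSpace m) (productForm r) e ≤ productVolume r :=
  le_iSup₂ (f := fun (e : OpenPartialHomeomorph (SphereProduct r) (ModelSpace m))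
    (_ : e ∈ IsManifold.maximalAtlas 𝓘(ℝ, ModelSpace m) ∞ (SphereProduct r)) =>
      chartVolume m (finrank_modelSpace m) (productForm r) e) e he

theorem contDiffAt_transition
    (he : e ∈ IsManifold.maximalAtlas 𝓘(ℝ, ModelSpace m) ∞ (SphereProduct r))
    (he' : e' ∈ IsManifold.maximalAtlas 𝓘(ℝ, ModelSpace m) ∞ (SphereProduct r))
    {y : ModelSpace m} (hy : y ∈ e.target) (hy' : e.symm y ∈ e'.source) :
    ContDiffAt ℝ ∞ (e' ∘ e.symm) y :=
  contMDiffAt_iff_contDiffAt.1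
    ((contMDiffAt_of_mem_maximalAtlas he' hy').comp y (contMDiffAt_symm_of_mem_maximalAtlas he hy))

theorem localForm_transition
    (he : e ∈ IsManifold.maximalAtlas 𝓘(ℝ, ModelSpace m) ∞ (SphereProduct r))
    (he' : e' ∈ IsManifold.maximalAtlas 𝓘(ℝ, ModelSpace m) ∞ (SphereProduct r))
    {y : ModelSpace m} (hy : y ∈ e.target) (hy' : e.symm y ∈ e'.source) :
    localForm (productForm r) e y = (localForm (productForm r) e' (e' (e.symm y))).compContinuousLinearMap
      (fderiv ℝ (e' ∘ e.symm) y) := by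
  have hy2 : e' (e.symm y) ∈ e'.target := e'.map_source hy'
  rw [localForm_productForm r he hy, localForm_productForm r he' hy2]
  ext w
  rw [ContinuousAlternatingMap.compContinuousLinearMap_apply, ContinuousAlternatingMap.sum_apply,
    ContinuousAlternatingMap.sum_apply]
  refine Finset.sum_congr rfl fun i _ => ?_
  have hev : coord r i ∘ e.symm =ᶠ[nhds y] (coord r i ∘ e'.symm) ∘ (e' ∘ e.symm) := by
    filter_upwards [(e.continuousAt_symm hy).preimage_mem_nhds
      (e'.open_source.mem_nhds hy')] with z hz
    exact congrArg (coord r i) (e'.left_inv hz).symm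
  have hd := (contDiffAt_transition he he' hy hy').differentiableAt (by simp)
  have hd2 : DifferentiableAt ℝ (coord r i ∘ e'.symm) ((e' ∘ e.symm) y) :=
    ((contDiffOn_coord_symm r he' i).contDiffAt (e'.open_target.mem_nhds hy2)).differentiableAt
      (by simp)
  rw [hev.fderiv_eq, hev.eq_of_nhds, fderiv_comp y hd2 hd]
  rfl

theorem chartDensity_transition
    (he : e ∈ IsManifold.maximalAtlas 𝓘(ℝ, ModelSpace m) ∞ (SphereProduct r))
    (he' : e' ∈ IsManifold.maximalAtlas 𝓘(ℝ, ModelSpace m) ∞ (SphereProduct r))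
    {y : ModelSpace m} (hy : y ∈ e.target) (hy' : e.symm y ∈ e'.source) :
    chartDensity m (finrank_modelSpace m) (productForm r) e y =
      |(fderiv ℝ (e' ∘ e.symm) y).det| *
        chartDensity m (finrank_modelSpace m) (productForm r) e' ((e' ∘ e.symm) y) := by
  rw [chartDensity, localForm_transition he he' hy hy', wedgePow_compContinuousLinearMap, abs_mul]
  rfl

/-- Change of variables along the transition map: the Jacobian is exactly the factor by which the
two densities differ. -/
theorem chartVolume_eq_of_subset
    (he : e ∈ IsManifold.maximalAtlas 𝓘(ℝ, ModelSpace m) ∞ (SphereProduct r))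
    (he' : e' ∈ IsManifold.maximalAtlas 𝓘(ℝ, ModelSpace m) ∞ (SphereProduct r))
    {A : Set (SphereProduct r)} (hA : MeasurableSet A) (h : A ⊆ e.source) (h' : A ⊆ e'.source) :
    chartVolume m (finrank_modelSpace m) (productForm r) e' A =
      chartVolume m (finrank_modelSpace m) (productForm r) e A := by
  have himage : (e' ∘ e.symm) '' (e.symm ⁻¹' A ∩ e.target) = e'.symm ⁻¹' A ∩ e'.target := by
    ext z
    constructor
    · rintro ⟨y, ⟨hyA, hy⟩, rfl⟩
      refine ⟨?_, e'.map_source (h' hyA)⟩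
      rwa [mem_preimage, Function.comp_apply, e'.left_inv (h' hyA)]
    · rintro ⟨hzA, hz⟩
      refine ⟨e (e'.symm z), ⟨?_, e.map_source (h hzA)⟩, ?_⟩
      · rwa [mem_preimage, e.left_inv (h hzA)]
      · rw [Function.comp_apply, e.left_inv (h hzA), e'.right_inv hz]
  have hinj : InjOn (e' ∘ e.symm) (e.symm ⁻¹' A ∩ e.target) := by
    rintro y ⟨hyA, hy⟩ z ⟨hzA, hz⟩ hyz
    exact e.symm.injOn hy hz (e'.injOn (h' hyA) (h' hzA) hyz)
  have hS := measurableSet_preimage_symm_inter_target e hA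
  rw [chartVolume_apply _ _ _ _ hA, chartVolume_apply _ _ _ _ hA, ← himage,
    lintegral_image_eq_lintegral_abs_det_fderiv_mul _ hS
      (fun y hy => (((contDiffAt_transition he he' hy.2 (h' hy.1)).differentiableAt
        (by simp)).hasFDerivAt).hasFDerivWithinAt) hinj]
  refine setLIntegral_congr_fun hS fun y hy => ?_
  rw [chartDensity_transition he he' hy.2 (h' hy.1), ENNReal.ofReal_mul (abs_nonneg _)]

/-- A supremum of measures is not computed set by set, so it is bounded by a single measure that
dominates every chart volume: that of `e`, plus the supremum itself off the source of `e`. On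
subsets of the source the extra term vanishes. -/
theorem productVolume_apply_le
    (he : e ∈ IsManifold.maximalAtlas 𝓘(ℝ, ModelSpace m) ∞ (SphereProduct r))
    {A : Set (SphereProduct r)} (hA : MeasurableSet A) (h : A ⊆ e.source) :
    productVolume r A ≤ chartVolume m (finrank_modelSpace m) (productForm r) e A := by
  have hle : productVolume r ≤ chartVolume m (finrank_modelSpace m) (productForm r) e +
      (productVolume r).restrict e.sourceᶜ := by
    refine iSup₂_le fun e' he' => Measure.le_iff.2 fun B hB => ?_
    rw [← measure_inter_add_sdiff B e.open_source.measurableSet, Measure.add_apply,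
      Measure.restrict_apply hB]
    refine add_le_add ?_ (chartVolume_le_productVolume he' _)
    have hB1 : MeasurableSet (B ∩ e.source) := hB.inter e.open_source.measurableSet
    rw [← chartVolume_inter_source _ _ _ _ hB1, chartVolume_eq_of_subset he he'
      (hB1.inter e'.open_source.measurableSet) (fun x hx => hx.1.2) (fun x hx => hx.2)]
    exact measure_mono fun x hx => hx.1.1
  refine (hle A).trans ?_
  rw [Measure.add_apply, Measure.restrict_apply hA, ← sdiff_eq, sdiff_eq_empty.2 h, measure_empty,
    add_zero]

theorem continuousOn_chartDensity
    (he : e ∈ IsManifold.maximalAtlas 𝓘(ℝ, ModelSpace m) ∞ (SphereProduct r)) :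
    ContinuousOn (chartDensity m (finrank_modelSpace m) (productForm r) e) e.target := by
  have h := (contDiffOn_localForm r he).continuousOn
  have h1 : ∀ v : Fin 2 → ModelSpace m,
      ContinuousOn (fun y => localForm (productForm r) e y v) e.target := fun v =>
    (continuous_eval_const v).comp_continuousOn h
  unfold chartDensity wedgePow
  refine ContinuousOn.abs (continuousOn_const.mul (continuousOn_finsetSum _ fun σ _ =>
    continuousOn_const.mul (continuousOn_finsetProd _ fun i _ => h1 _)))

instance : IsLocallyFiniteMeasure (productVolume r) := by
  refine ⟨fun x => ?_⟩
  let e := chartAt (ModelSpace m) x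
  have he : e ∈ IsManifold.maximalAtlas 𝓘(ℝ, ModelSpace m) ∞ (SphereProduct r) :=
    IsManifold.chart_mem_maximalAtlas x
  have hx : x ∈ e.source := mem_chart_source _ x
  have hy : e x ∈ e.target := e.map_source hx
  let d := chartDensity m (finrank_modelSpace m) (productForm r) e
  have hd : ContinuousAt d (e x) :=
    (continuousOn_chartDensity he).continuousAt (e.open_target.mem_nhds hy)
  obtain ⟨ρ, hρ, hball⟩ := Metric.eventually_nhds_iff_ball.1
    (hd.eventually (gt_mem_nhds (lt_add_one (d (e x)))))
  let U := e.source ∩ e ⁻¹' Metric.ball (e x) ρ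
  have hU : IsOpen U := e.isOpen_inter_preimage Metric.isOpen_ball
  refine ⟨U, hU.mem_nhds ⟨hx, Metric.mem_ball_self hρ⟩, ?_⟩
  refine (productVolume_apply_le he hU.measurableSet inter_subset_left).trans_lt ?_
  rw [chartVolume_apply _ _ _ _ hU.measurableSet]
  have hsub : e.symm ⁻¹' U ∩ e.target ⊆ Metric.ball (e x) ρ := fun y hy => by
    have := hy.1.2
    rwa [mem_preimage, e.right_inv hy.2] at this
  refine (lintegral_mono_set hsub).trans_lt ?_
  refine (setLIntegral_mono (g := fun _ => ENNReal.ofReal (d (e x) + 1)) measurable_const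
    fun y hy => ENNReal.ofReal_le_ofReal (hball y hy).le).trans_lt ?_
  rw [setLIntegral_const]
  exact ENNReal.mul_lt_top ENNReal.ofReal_lt_top measure_ball_lt_top

instance : IsFiniteMeasure (productVolume r) := ⟨isCompact_univ.measure_lt_top⟩

/-- The symplectic basis at the pole makes the density there nonzero; by continuity it is bounded
below on a ball, which has positive Lebesgue measure. -/
theorem IsPole.productVolume_ne_zero {ε : Fin m → ℤ} {s : SphereProduct r} (hs : IsPole r ε s) :
    productVolume r univ ≠ 0 := by
  let e := chartAt (ModelSpace m) s
  have he : e ∈ IsManifold.maximalAtlas 𝓘(ℝ, ModelSpace m) ∞ (SphereProduct r) :=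
    IsManifold.chart_mem_maximalAtlas s
  have hx : s ∈ e.source := mem_chart_source _ s
  have hy : e s ∈ e.target := e.map_source hx
  let d := chartDensity m (finrank_modelSpace m) (productForm r) e
  -- The tangent space at `s` is the model space through this very chart, so the local form at `e s`
  -- is the form itself.
  have hform : localForm (productForm r) e (e s) =
      (productForm r s : ModelSpace m [⋀^Fin 2]→L[ℝ] ℝ) := by
    rw [localForm_productForm r he hy]
    ext w
    refine Eq.trans ?_ ((alternating_apply_pair (V := ModelSpace m) (productForm r s) w).trans
      (productForm_apply r s (w 0) (w 1))).symm
    rw [ContinuousAlternatingMap.sum_apply]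
    refine Finset.sum_congr rfl fun i _ => ?_
    rw [mvfderiv_coord_eq, Function.comp_apply, e.left_inv hx]
    refine congrArg (areaForm (r i) (coord r i s)) ?_
    ext j : 1
    fin_cases j <;> rfl
  have hpos : 0 < d (e s) := by
    refine abs_pos.2 ?_
    rw [hform]
    let b := Basis.ofEquivFun hs.poleEquiv
    have hb : ∀ k, poleCoordinates ε s (b k) = Pi.single k 1 := fun k => by
      rw [← hs.poleEquiv_apply, Basis.coe_ofEquivFun, LinearEquiv.apply_symm_apply]
    refine wedgePow_basis_ne_zero_of_orthogonal _ _
      (fun p => b (if p.2 = 0 then .inl p.1 else .inr p.1)) (fun i i' hii' j j' => ?_) fun i => ?_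
    · refine (hs.productForm_apply_eq _ _).trans ?_
      simp only [hb]
      refine Finset.sum_eq_zero fun l _ => ?_
      fin_cases j <;> fin_cases j' <;> by_cases hl : l = i <;> simp [Pi.single_apply, hl, hii']
    · refine ((hs.productForm_apply_eq _ _).trans ?_).trans_ne one_ne_zero
      simp only [hb]
      simp [Pi.single_apply]
  have hd : ContinuousAt d (e s) :=
    (continuousOn_chartDensity he).continuousAt (e.open_target.mem_nhds hy)
  obtain ⟨ρ, hρ, hball⟩ := Metric.eventually_nhds_iff_ball.1
    ((hd.eventually (lt_mem_nhds (half_lt_self hpos))).and (e.open_target.mem_nhds hy))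
  refine ((lt_of_lt_of_le ?_ (chartVolume_le_productVolume he univ)).ne')
  rw [chartVolume_apply _ _ _ _ MeasurableSet.univ, preimage_univ, univ_inter]
  have hsub : Metric.ball (e s) ρ ⊆ e.target := fun y hy => (hball y hy).2
  refine lt_of_lt_of_le ?_ (lintegral_mono_set hsub)
  refine lt_of_lt_of_le ?_ (setLIntegral_mono' (f := fun _ => ENNReal.ofReal (d (e s) / 2))
    Metric.isOpen_ball.measurableSet fun y hy => ENNReal.ofReal_le_ofReal (hball y hy).1.le)
  rw [setLIntegral_const]
  exact ENNReal.mul_pos (ENNReal.ofReal_pos.2 (half_pos hpos)).ne'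
    (Metric.measure_ball_pos _ _ hρ).ne'

end Volume

/-! ## The antipodal map -/

section Antipode

variable {m : ℕ} (r : Fin m → Radius)

/-- The antipodal map in every factor. -/
def antipode : SphereProduct r ≃ₜ SphereProduct r where
  toFun x i := -x i
  invFun x i := -x i
  left_inv x := funext fun i => neg_neg (x i)
  right_inv x := funext fun i => neg_neg (x i)
  continuous_toFun := continuous_pi (A := fun i => RoundSphere (r i)) fun i =>
    (continuous_apply (A := fun i => RoundSphere (r i)) i).neg
  continuous_invFun := continuous_pi (A := fun i => RoundSphere (r i)) fun i =>
    (continuous_apply (A := fun i => RoundSphere (r i)) i).neg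

theorem coord_antipode (i : Fin m) (x : SphereProduct r) :
    coord r i (antipode r x) = -coord r i x := rfl

theorem antipode_antipode (x : SphereProduct r) : antipode r (antipode r x) = x :=
  (antipode r).left_inv x

theorem contMDiff_antipode :
    ContMDiff 𝓘(ℝ, ModelSpace m) 𝓘(ℝ, ModelSpace m) ∞ (antipode r) :=
  contMDiff_of_coord fun i => contDiff_neg.contMDiff.comp (contMDiff_coord r i)

variable {r} {e : OpenPartialHomeomorph (SphereProduct r) (ModelSpace m)}

/-- The chart `e`, precomposed with the antipodal map. -/
def antipodalChart (e : OpenPartialHomeomorph (SphereProduct r) (ModelSpace m)) :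
    OpenPartialHomeomorph (SphereProduct r) (ModelSpace m) :=
  (antipode r).toOpenPartialHomeomorph ≫ₕ e

theorem antipodalChart_target : (antipodalChart e).target = e.target := by
  simp [antipodalChart]

theorem antipodalChart_symm_apply (y : ModelSpace m) :
    (antipodalChart e).symm y = antipode r (e.symm y) := rfl

/-- The volume is a supremum over the maximal atlas, so its symmetry requires that the atlas be
stable under the antipodal map. -/
theorem antipodalChart_mem_maximalAtlas
    (he : e ∈ IsManifold.maximalAtlas 𝓘(ℝ, ModelSpace m) ∞ (SphereProduct r)) :
    antipodalChart e ∈ IsManifold.maximalAtlas 𝓘(ℝ, ModelSpace m) ∞ (SphereProduct r) := by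
  refine OpenPartialHomeomorph.mem_maximalAtlas_of_contMDiffOn _ ?_ ?_
  · exact (contMDiffOn_of_mem_maximalAtlas he).comp (contMDiff_antipode r).contMDiffOn
      fun x hx => hx.2
  · rw [antipodalChart_target]
    exact (contMDiff_antipode r).comp_contMDiffOn (contMDiffOn_symm_of_mem_maximalAtlas he)

/-- The base point and both vectors change sign, and `det3` is cubic in them. -/
theorem localForm_antipodalChart
    (he : e ∈ IsManifold.maximalAtlas 𝓘(ℝ, ModelSpace m) ∞ (SphereProduct r))
    {y : ModelSpace m} (hy : y ∈ e.target) :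
    localForm (productForm r) (antipodalChart e) y = -localForm (productForm r) e y := by
  rw [localForm_productForm r he hy, localForm_productForm r (antipodalChart_mem_maximalAtlas he)
    (antipodalChart_target.symm ▸ hy), ← Finset.sum_neg_distrib]
  refine Finset.sum_congr rfl fun i _ => ?_
  have h : coord r i ∘ (antipodalChart e).symm = -(coord r i ∘ e.symm) := by
    ext1 z
    rw [Function.comp_apply, antipodalChart_symm_apply, coord_antipode]
    rfl
  generalize coord r i ∘ e.symm = g at h
  rw [h, fderiv_neg, Pi.neg_apply]
  ext w
  rw [ContinuousAlternatingMap.neg_apply, ContinuousAlternatingMap.compContinuousLinearMap_apply,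
    ContinuousAlternatingMap.compContinuousLinearMap_apply, alternating_apply_pair,
    alternating_apply_pair _ (_ ∘ w), ← areaForm_neg]
  rfl

theorem chartVolume_antipodalChart
    (he : e ∈ IsManifold.maximalAtlas 𝓘(ℝ, ModelSpace m) ∞ (SphereProduct r))
    {A : Set (SphereProduct r)} (hA : MeasurableSet A) :
    chartVolume m (finrank_modelSpace m) (productForm r) (antipodalChart e) A =
      chartVolume m (finrank_modelSpace m) (productForm r) e (antipode r ⁻¹' A) := by
  have hA' : MeasurableSet (antipode r ⁻¹' A) := (antipode r).continuous.measurable hA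
  rw [chartVolume_apply _ _ _ _ hA, chartVolume_apply _ _ _ _ hA', antipodalChart_target]
  have hset : (antipodalChart e).symm ⁻¹' A = e.symm ⁻¹' (antipode r ⁻¹' A) := rfl
  rw [hset]
  refine setLIntegral_congr_fun (measurableSet_preimage_symm_inter_target e hA') fun y hy => ?_
  rw [chartDensity, localForm_antipodalChart he hy.2, wedgePow_neg]
  rfl

theorem measurePreserving_antipode :
    MeasurePreserving (antipode r) (productVolume r) (productVolume r) := by
  have hmeas : Measurable (antipode r) := (antipode r).continuous.measurable
  have hinv : ∀ A, antipode r ⁻¹' (antipode r ⁻¹' A) = A := fun A => by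
    ext x
    simp only [mem_preimage, antipode_antipode]
  have hle : productVolume r ≤ (productVolume r).map (antipode r) := by
    refine iSup₂_le fun e he => Measure.le_iff.2 fun A hA => ?_
    rw [Measure.map_apply hmeas hA, ← hinv A, ← chartVolume_antipodalChart he (hmeas hA), hinv]
    exact chartVolume_le_productVolume (antipodalChart_mem_maximalAtlas he) _
  -- The reverse inequality is the first one at the preimage, since the map is an involution.
  refine ⟨hmeas, le_antisymm (Measure.le_iff.2 fun A hA => ?_) hle⟩
  rw [Measure.map_apply hmeas hA]
  have h := hle (antipode r ⁻¹' A)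
  rwa [Measure.map_apply hmeas (hmeas hA), hinv] at h

theorem integral_weightedHeight (c : Fin m → ℤ) :
    ∫ x, weightedHeight r c x ∂(productVolume r) = 0 := by
  have h1 := (measurePreserving_antipode (r := r)).integral_comp
    (antipode r).measurableEmbedding (weightedHeight r c)
  have h2 : ∀ x, weightedHeight r c (antipode r x) = -weightedHeight r c x := fun x => by
    simp [weightedHeight, height, coord_antipode]
  simp only [h2, integral_neg] at h1
  linarith

end Antipode

/-! ## Rotations of products of spheres as unbalanced circle actions -/

section Unbalanced

variable {m : ℕ} {r : Fin m → Radius} {ε : Fin m → ℤ} {s : SphereProduct r}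

theorem IsPole.weightedHeight_eq (hs : IsPole r ε s) (c : Fin m → ℤ) :
    weightedHeight r c s = ∑ i, 2 * Real.pi * (ε i * c i) * (r i).1 ^ 2 := by
  refine Finset.sum_congr rfl fun i _ => ?_
  rw [height, hs.coord_eq]
  simp
  ring

theorem integrable_weightedHeight (r : Fin m → Radius) (c : Fin m → ℤ) :
    Integrable (weightedHeight r c) (productVolume r) := by
  have h : Continuous (weightedHeight r c) := (contMDiff_weightedHeight r c).continuous
  obtain ⟨C, hC⟩ := isCompact_univ.exists_bound_of_continuousOn h.continuousOn
  exact Integrable.of_bound h.aestronglyMeasurable C (.of_forall fun x => hC x (mem_univ x))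

theorem IsPole.volume_mul_ne_zero (hs : IsPole r ε s) {a : ℝ} (ha : a ≠ 0) :
    (productVolume r).real univ * a ≠ 0 :=
  mul_ne_zero (ENNReal.toReal_ne_zero.2 ⟨hs.productVolume_ne_zero, measure_ne_top _ _⟩) ha

theorem IsPole.isMaslovZeroUnbalanced (hs : IsPole r ε s) {c : Fin m → ℤ}
    (hc : ∑ i, ε i * c i = 0) (hF : weightedHeight r c s ≠ 0) :
    IsMaslovZeroUnbalanced m (finrank_modelSpace m) (productForm r) (weightedHeight r c)
      (rotationAction r c) s where
  symplectic := isClosedSymplecticManifold_productForm r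
  action := isHamiltonianCircleAction_rotationAction r c
  maslov := hs.isMaslovZeroFixedPoint c hc
  volume_ne_top := measure_ne_top (productVolume r) univ
  integrable := integrable_weightedHeight r c
  integral_ne := by
    rw [integral_weightedHeight]
    exact (hs.volume_mul_ne_zero hF).symm

end Unbalanced

end HamLoop

end

/-! ### The two families: weights and poles with `∑ ε i * c i = 0` -/

theorem mainTheorem4 (r₁ r₂ : Radius) (hr : r₁ ≠ r₂) :
    -- the product of two spheres
    (let r : Fin 2 → Radius := ![r₁, r₂]
     let F : SphereProduct r → ℝ := fun x =>
       2 * Real.pi * r₁.1 * height r 0 x + 2 * Real.pi * r₂.1 * height r 1 x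
     let s : SphereProduct r := fun i => if i = 0 then northPole (r i) else southPole (r i)
     let vol : Measure (SphereProduct r) :=
       symplecticVolume 2 (finrank_modelSpace 2) (productForm r)
     ∃ f : ℝ → SphereProduct r → SphereProduct r,
       IsMaslovZeroUnbalanced 2 (finrank_modelSpace 2) (productForm r) F f s ∧
       F s = 2 * Real.pi * r₁.1 ^ 2 - 2 * Real.pi * r₂.1 ^ 2 ∧
       ∫ x, F x ∂vol = 0 ∧ vol.real univ * F s ≠ 0) ∧
    -- the product of `m = k + 1` spheres
    (∀ k : ℕ, 1 ≤ k →
     let r : Fin (k + 1) → Radius := fun i => if i = Fin.last k then r₂ else r₁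
     let F : SphereProduct r → ℝ := fun x =>
       2 * Real.pi * ((∑ i : Fin k, r₁.1 * height r i.castSucc x) +
         k * r₂.1 * height r (Fin.last k) x)
     let s : SphereProduct r := fun i =>
       if i = Fin.last k then southPole (r i) else northPole (r i)
     let vol : Measure (SphereProduct r) :=
       symplecticVolume (k + 1) (finrank_modelSpace (k + 1)) (productForm r)
     ∃ f : ℝ → SphereProduct r → SphereProduct r,
       IsMaslovZeroUnbalanced (k + 1) (finrank_modelSpace (k + 1)) (productForm r) F f s ∧
       F s ≠ 0 ∧ ∫ x, F x ∂vol = 0 ∧ vol.real univ * F s ≠ 0) := by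
  have hsq : r₁.1 ^ 2 - r₂.1 ^ 2 ≠ 0 := fun h => by
    refine hr (Subtype.ext ?_)
    exact (sq_eq_sq₀ r₁.2.le r₂.2.le).1 (sub_eq_zero.1 h)
  have hpi := Real.pi_pos
  refine ⟨?_, fun k hk => ?_⟩
  · intro r F s vol
    have hF : F = weightedHeight r fun _ => 1 := by
      ext x
      simp [F, weightedHeight, Fin.sum_univ_two, r]
    have hs : IsPole r ![1, -1] s := by
      refine ⟨fun i => ?_, fun i => ?_⟩
      · fin_cases i <;> simp
      · fin_cases i <;> simp [s, coord, northPole, southPole]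
    have hc : ∑ i, (![1, -1] : Fin 2 → ℤ) i * (fun _ => 1 : Fin 2 → ℤ) i = 0 := by
      simp [Fin.sum_univ_two]
    have hFs : F s = 2 * Real.pi * r₁.1 ^ 2 - 2 * Real.pi * r₂.1 ^ 2 := by
      rw [hF, hs.weightedHeight_eq, Fin.sum_univ_two]
      simp [r]
      ring
    have hne : F s ≠ 0 := by
      rw [hFs, ← mul_sub]
      exact mul_ne_zero (by positivity) hsq
    refine ⟨rotationAction r fun _ => 1, ?_, hFs, ?_, hs.volume_mul_ne_zero hne⟩
    · rw [hF] at hne ⊢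
      exact hs.isMaslovZeroUnbalanced hc hne
    · rw [hF]
      exact integral_weightedHeight _
  · intro r F s vol
    -- Here `k = m - 1`. The weight `k` at the single south pole balances the `k` north poles of
    -- weight `1`.
    let c : Fin (k + 1) → ℤ := fun i => if i = Fin.last k then k else 1
    let ε : Fin (k + 1) → ℤ := fun i => if i = Fin.last k then -1 else 1
    have hlast : ∀ i : Fin k, i.castSucc ≠ Fin.last k := fun i => i.castSucc_lt_last.ne
    have hF : F = weightedHeight r c := by
      ext x
      simp only [F, weightedHeight, Fin.sum_univ_castSucc, r, c, hlast, if_true, if_false,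
        mul_add, Finset.mul_sum]
      congr 1
      · exact Finset.sum_congr rfl fun i _ => by push_cast; ring
      · push_cast; ring
    have hs : IsPole r ε s := by
      refine ⟨fun i => ?_, fun i => ?_⟩
      · by_cases hi : i = Fin.last k <;> simp [ε, hi]
      · by_cases hi : i = Fin.last k <;> simp [s, coord, northPole, southPole, ε, hi]
    have hc : ∑ i, ε i * c i = 0 := by
      simp [Fin.sum_univ_castSucc, ε, c, hlast]
    have hne : F s ≠ 0 := by
      have h : F s = 2 * Real.pi * k * (r₁.1 ^ 2 - r₂.1 ^ 2) := by
        rw [hF, hs.weightedHeight_eq, Fin.sum_univ_castSucc]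
        simp [ε, c, hlast, r]
        ring
      rw [h]
      have hk' : (k : ℝ) ≠ 0 := Nat.cast_ne_zero.2 (by omega)
      exact mul_ne_zero (by positivity) hsq
    refine ⟨rotationAction r c, ?_, hne, ?_, hs.volume_mul_ne_zero hne⟩
    · rw [hF] at hne ⊢
      exact hs.isMaslovZeroUnbalanced hc hne
    · rw [hF]
      exact integral_weightedHeight _
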